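/- Let $R>0$ and let $B(0,R)\subset\mathbb R^3$ be the open ball. For $s\ge 0$ let $\|f\|_{H^s(\mathbb R^3)}=\|(1+|\xi|^2)^{s/2}\hat f\|_{L^2(\mathbb R^3)}$ (with $\hat f(\xi)=\int_{\mathbb R^3} e^{-2\pi i x\cdot\xi}f(x)\,dx$, extended to $L^2$), let $\|f\|_{H^s(B(0,R))}$ be the infimum of $\|\bar f\|_{H^s(\mathbb R^3)}$ over all extensions $\bar f:\mathbb R^3\to\mathbb R$ of $f$ (with value $+\infty$ if no extension is in $H^s(\mathbb R^3)$), and for a covariant $2$-tensor let $\|k\|_{H^s(B(0,R))}=\sum_{i,j=1}^3\|k_{ij}\|_{H^s(B(0,R))}$ with Cartesian components $k_{ij}$. For a Riemannian metric $g$ and a symmetric covariant $2$-tensor $k$ on $B(0,R)$, a compact smooth embedded $2$-surface $S\subset B(0,R)$ is called trapped if, at every point of $S$, $\mathrm{tr}_{S}(k+h)<0$ and $\mathrm{tr}_{S}(k-h)<0$, where $h(X,Y)=g(\nabla_XN,Y)$ is the second fundamental form of $S$ with respect to a $g$-unit normal $N$, and $\mathrm{tr}_S$ is the trace over the tangent plane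 of $S$ with respect to the metric induced by $g$. **Proposition.** There exists an absolute constant $\epsilon_0>0$ (in particular, independent of $R$) such that the following holds for every $R>0$. Let $g$ be a smooth Riemannian metric and $k$ a smooth symmetric covariant $2$-tensor on $B(0,R)$ which away from the origin are of the form $$g=d\rho^2+r(\rho)^2\,(d\vartheta^2+\sin^2\vartheta\,d\varphi^2),\qquad k=k_{\rho\rho}(\rho)\,d\rho^2+k_{\vartheta\vartheta}(\rho)\,(d\vartheta^2+\sin^2\vartheta\,d\varphi^2),$$ with $r>0$ on $(0,R)$; that is, in the Cartesian coordinates $x=\rho(\sin\vartheta\cos\varphi,\sin\vartheta\sin\varphi,\cos\vartheta)$, for $x\ne0$, $$g_{ij}=\frac{r^2(|x|)}{|x|^2}\delta_{ij}+\Big(1-\frac{r^2(|x|)}{|x|^2}\Big)\frac{x^ix^j}{|x|^2},\qquad k_{ij}=\frac{k_{\vartheta\vartheta}(|x|)}{|x|^2}\delta_{ij}+\Big(k_{\rho\rho}(|x|)-\frac{k_{\vartheta\vartheta}(|x|)}{|x|^2}\Big)\frac{x^ix^j}{|x|^2}.$$ Let $\psi_0,\psi_1:B(0,R)\to\mathbb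 R$ be smooth and spherically symmetric, and suppose that the constraint equations of the Einstein--scalar field system $$R[g]+(\mathrm{tr}_gk)^2-\|k\|_g^2=\|\nabla\psi_0\|_g^2+\psi_1^2,\qquad \mathrm{div}_g k-\nabla(\mathrm{tr}_gk)=\psi_1\nabla\psi_0$$ hold on $B(0,R)$, where $R[g]$ is the scalar curvature of $g$. If $$\|k\|_{H^{1/2}(B(0,R))}+\|\psi_0\|_{H^{3/2}(B(0,R))}+\|\psi_1\|_{H^{1/2}(B(0,R))}\le\epsilon_0,$$ then there is no non-empty compact smooth embedded $2$-surface $S\subset B(0,R)$ that is spherically symmetric (invariant under the rotations about the origin) and trapped in $(B(0,R),g,k)$. -/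

import Mathlib

open MeasureTheory Topology Metric
open scoped ENNReal ContDiff FourierTransform

namespace SphericalData

/-- Euclidean three-space with its Cartesian coordinates `x 0, x 1, x 2`. -/
abbrev E3 : Type := EuclideanSpace ℝ (Fin 3)

/-- A covariant 2-tensor on (a subset of) `ℝ³`, given by its Cartesian components. -/
abbrev Tensor2 : Type := E3 → Matrix (Fin 3) (Fin 3) ℝ

noncomputable section

/-! ### Sobolev norms -/

/-- The norm of `H^s(ℝ³)`, `s ≥ 0`: the `L²` norm of `(1 + |ξ|²)^{s/2} 𝓕 f`, where `𝓕` is the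
Fourier transform on `L²`. It is `∞` if `f` is not in `H^s(ℝ³)`; in particular the infimum is
over the empty family, hence `∞`, if `f` is not in `L²`. -/
def sobolevNorm (s : ℝ) (f : E3 → ℝ) : ℝ≥0∞ :=
  ⨅ hf : MemLp (fun x => (f x : ℂ)) 2 (volume : Measure E3),
    (∫⁻ ξ : E3, ENNReal.ofReal ((1 + ‖ξ‖ ^ 2) ^ s) *
      ‖(𝓕 (hf.toLp (fun x => (f x : ℂ))) : Lp ℂ 2 (volume : Measure E3)) ξ‖ₑ ^ 2) ^ (1 / 2 : ℝ)

/-- The norm of `H^s(Ω)`: the infimum of the `H^s(ℝ³)` norms of all the extensions of `f`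
from `Ω` to `ℝ³` (so it is `∞` if there is no extension in `H^s(ℝ³)`). -/
def sobolevNormOn (s : ℝ) (Ω : Set E3) (f : E3 → ℝ) : ℝ≥0∞ :=
  ⨅ (F : E3 → ℝ) (_ : Set.EqOn F f Ω), sobolevNorm s F

/-- The `H^s(Ω)` norm of a covariant 2-tensor: the sum over its Cartesian components. -/
def tensorSobolevNormOn (s : ℝ) (Ω : Set E3) (T : Tensor2) : ℝ≥0∞ :=
  ∑ i, ∑ j, sobolevNormOn s Ω (fun x => T x i j)

/-! ### Riemannian geometry in Cartesian coordinates -/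

/-- The components of `T` are smooth on `Ω`. -/
def SmoothTensorOn (T : Tensor2) (Ω : Set E3) : Prop :=
  ∀ i j, ContDiffOn ℝ ∞ (fun x => T x i j) Ω

/-- A smooth Riemannian metric on `Ω`. -/
def IsRiemannianMetricOn (g : Tensor2) (Ω : Set E3) : Prop :=
  SmoothTensorOn g Ω ∧ ∀ x ∈ Ω, (g x).PosDef

/-- A smooth symmetric covariant 2-tensor on `Ω`. -/
def IsSymmetricTensorOn (k : Tensor2) (Ω : Set E3) : Prop :=
  SmoothTensorOn k Ω ∧ ∀ x ∈ Ω, (k x).IsSymm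

/-- The partial derivative `∂_i f`. -/
def pd (i : Fin 3) (f : E3 → ℝ) (x : E3) : ℝ :=
  fderiv ℝ f x (EuclideanSpace.single i 1)

/-- The value `T(u, v)` of a covariant 2-tensor at `x`. -/
def tensorApply (T : Tensor2) (x : E3) (u v : E3) : ℝ :=
  ∑ i, ∑ j, T x i j * u i * v j

/-- The Christoffel symbol `Γ^l_{ij}` of the Levi-Civita connection of `g`. -/
def christoffel (g : Tensor2) (l i j : Fin 3) (x : E3) : ℝ :=
  (1 / 2) * ∑ m, (g x)⁻¹ l m *
    (pd i (fun y => g y j m) x + pd j (fun y => g y i m) x - pd m (fun y => g y i j) x)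

/-- The Ricci tensor
`R_{ij} = ∂_l Γ^l_{ij} - ∂_j Γ^l_{il} + Γ^l_{lm} Γ^m_{ij} - Γ^l_{jm} Γ^m_{il}`. -/
def ricci (g : Tensor2) (i j : Fin 3) (x : E3) : ℝ :=
  ∑ l, (pd l (christoffel g l i j) x - pd j (christoffel g l i l) x +
    ∑ m, (christoffel g l l m x * christoffel g m i j x -
      christoffel g l j m x * christoffel g m i l x))

/-- The scalar curvature `R[g] = g^{ij} R_{ij}`. -/
def scalarCurvature (g : Tensor2) (x : E3) : ℝ :=
  ∑ i, ∑ j, (g x)⁻¹ i j * ricci g i j x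

/-- The trace `tr_g k = g^{ij} k_{ij}`. -/
def metricTrace (g k : Tensor2) (x : E3) : ℝ :=
  ∑ i, ∑ j, (g x)⁻¹ i j * k x i j

/-- The squared norm `‖k‖_g² = g^{ia} g^{jb} k_{ij} k_{ab}`. -/
def tensorNormSq (g k : Tensor2) (x : E3) : ℝ :=
  ∑ i, ∑ j, ∑ a, ∑ b, (g x)⁻¹ i a * (g x)⁻¹ j b * k x i j * k x a b

/-- The squared norm `‖∇ψ‖_g² = g^{ij} ∂_i ψ ∂_j ψ`. -/
def gradNormSq (g : Tensor2) (ψ : E3 → ℝ) (x : E3) : ℝ :=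
  ∑ i, ∑ j, (g x)⁻¹ i j * pd i ψ x * pd j ψ x

/-- The covariant derivative `∇_l k_{ij} = ∂_l k_{ij} - Γ^m_{li} k_{mj} - Γ^m_{lj} k_{im}`. -/
def covDerivTensor (g k : Tensor2) (l i j : Fin 3) (x : E3) : ℝ :=
  pd l (fun y => k y i j) x -
    ∑ m, (christoffel g m l i x * k x m j + christoffel g m l j x * k x i m)

/-- The divergence `(div_g k)_j = g^{li} ∇_l k_{ij}`. -/
def divergence (g k : Tensor2) (j : Fin 3) (x : E3) : ℝ :=
  ∑ l, ∑ i, (g x)⁻¹ l i * covDerivTensor g k l i j x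

/-- The Hamiltonian and the momentum constraint of the Einstein-scalar field system on `Ω`. -/
structure EinsteinScalarConstraintsOn (g k : Tensor2) (ψ₀ ψ₁ : E3 → ℝ) (Ω : Set E3) : Prop where
  hamiltonian : ∀ x ∈ Ω,
    scalarCurvature g x + metricTrace g k x ^ 2 - tensorNormSq g k x =
      gradNormSq g ψ₀ x + ψ₁ x ^ 2
  momentum : ∀ x ∈ Ω, ∀ j,
    divergence g k j x - pd j (metricTrace g k) x = ψ₁ x * pd j ψ₀ x

/-! ### Spherical symmetry -/

/-- `g = dρ² + r(ρ)² (dϑ² + sin²ϑ dφ²)` on `B(0,R) ∖ {0}`, written in the Cartesian coordinates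
`x = ρ (sin ϑ cos φ, sin ϑ sin φ, cos ϑ)`. -/
def HasSphericalMetricForm (g : Tensor2) (r : ℝ → ℝ) (R : ℝ) : Prop :=
  (∀ ρ ∈ Set.Ioo 0 R, 0 < r ρ) ∧
  ∀ x ∈ ball (0 : E3) R, x ≠ 0 → ∀ i j,
    g x i j = r ‖x‖ ^ 2 / ‖x‖ ^ 2 * (if i = j then 1 else 0) +
      (1 - r ‖x‖ ^ 2 / ‖x‖ ^ 2) * (x i * x j / ‖x‖ ^ 2)

/-- `k = k_ρρ(ρ) dρ² + k_ϑϑ(ρ) (dϑ² + sin²ϑ dφ²)` on `B(0,R) ∖ {0}`, written in the Cartesian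
coordinates `x = ρ (sin ϑ cos φ, sin ϑ sin φ, cos ϑ)`. -/
def HasSphericalTensorForm (k : Tensor2) (kρρ kϑϑ : ℝ → ℝ) (R : ℝ) : Prop :=
  ∀ x ∈ ball (0 : E3) R, x ≠ 0 → ∀ i j,
    k x i j = kϑϑ ‖x‖ / ‖x‖ ^ 2 * (if i = j then 1 else 0) +
      (kρρ ‖x‖ - kϑϑ ‖x‖ / ‖x‖ ^ 2) * (x i * x j / ‖x‖ ^ 2)

/-- `ψ` is a spherically symmetric function on `B(0,R)`. -/
def IsRadialOn (ψ : E3 → ℝ) (R : ℝ) : Prop :=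
  ∀ x ∈ ball (0 : E3) R, ∀ y ∈ ball (0 : E3) R, ‖x‖ = ‖y‖ → ψ x = ψ y

/-- `S` is spherically symmetric: it is mapped to itself by the linear isometries of `ℝ³`.
(The rotations alone have the same orbits, so they have the same invariant sets.) -/
def IsSphericallySymmetricSet (S : Set E3) : Prop :=
  ∀ A : E3 ≃ₗᵢ[ℝ] E3, A '' S = S

/-! ### Surfaces -/

/-- `S` is a (non-empty) compact smooth embedded 2-surface in `ℝ³`: near each of its points it
is a regular level set of a smooth function. It need not be connected. -/
structure IsCompactEmbeddedSurface (S : Set E3) : Prop where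
  nonempty : S.Nonempty
  isCompact : IsCompact S
  locallyRegular : ∀ p ∈ S, ∃ U : Set E3, IsOpen U ∧ p ∈ U ∧ ∃ F : E3 → ℝ,
    ContDiffOn ℝ ∞ F U ∧ (∀ q ∈ U, fderiv ℝ F q ≠ 0) ∧ S ∩ U = {q ∈ U | F q = 0}

/-- The tangent space `T_p S`, as the set of velocities at `p` of curves in `S`. -/
def tangentVectors (S : Set E3) (p : E3) : Set E3 :=
  {v | ∃ γ : ℝ → E3, γ 0 = p ∧ HasDerivAt γ v 0 ∧ ∀ᶠ t in 𝓝 0, γ t ∈ S}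

/-- Near `p`, the vector field `N` is smooth and restricts to a `g`-unit normal field on `S`. -/
structure IsLocalUnitNormal (g : Tensor2) (S : Set E3) (p : E3) (N : E3 → E3) : Prop where
  smooth : ContDiffAt ℝ ∞ N p
  unit : ∀ᶠ q in 𝓝[S] p, tensorApply g q (N q) (N q) = 1
  normal : ∀ᶠ q in 𝓝[S] p, ∀ v ∈ tangentVectors S q, tensorApply g q (N q) v = 0

/-- The covariant derivative `(∇_X N)^l = X^i (∂_i N^l + Γ^l_{ij} N^j)` at `p`. -/
def covDerivVector (g : Tensor2) (N : E3 → E3) (p : E3) (X : E3) (l : Fin 3) : ℝ :=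
  ∑ i, X i * (pd i (fun y => N y l) p + ∑ j, christoffel g l i j p * N p j)

/-- The second fundamental form `h(X, Y) = g(∇_X N, Y)` at `p`. -/
def secondFundamentalForm (g : Tensor2) (N : E3 → E3) (p : E3) (X Y : E3) : ℝ :=
  ∑ l, ∑ j, g p l j * covDerivVector g N p X l * Y j

/-- `e₁, e₂` is a `g`-orthonormal basis of the tangent plane `T_p S`. -/
structure IsTangentFrame (g : Tensor2) (S : Set E3) (p e₁ e₂ : E3) : Prop where
  mem₁ : e₁ ∈ tangentVectors S p
  mem₂ : e₂ ∈ tangentVectors S p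
  unit₁ : tensorApply g p e₁ e₁ = 1
  unit₂ : tensorApply g p e₂ e₂ = 1
  orthogonal : tensorApply g p e₁ e₂ = 0

/-- `S` is trapped in `(Ω, g, k)`: it lies in `Ω`, and at every point of `S` the traces over the
tangent plane of `k + h` and of `k - h` are both negative. The traces are computed in an
orthonormal basis, on which they do not depend. Replacing `N` by `-N` replaces `h` by `-h` and
exchanges the two inequalities, so the choice of the unit normal does not matter either. -/
def IsTrapped (g k : Tensor2) (Ω S : Set E3) : Prop :=
  S ⊆ Ω ∧ ∀ p ∈ S, ∃ (N : E3 → E3) (e₁ e₂ : E3),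
    IsLocalUnitNormal g S p N ∧ IsTangentFrame g S p e₁ e₂ ∧
    (tensorApply k p e₁ e₁ + secondFundamentalForm g N p e₁ e₁) +
      (tensorApply k p e₂ e₂ + secondFundamentalForm g N p e₂ e₂) < 0 ∧
    (tensorApply k p e₁ e₁ - secondFundamentalForm g N p e₁ e₁) +
      (tensorApply k p e₂ e₂ - secondFundamentalForm g N p e₂ e₂) < 0

end

end SphericalData

open SphericalData

/-! Write r for the area radius, κ = k_ϑϑ / r, u = k_ρρ, and a prime for d/dρ. The two traces on the
sphere of radius ρ are 2(κ ± r')/r, so that sphere is trapped exactly when κ < -|r'|. The theorem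
therefore reduces to |κ| < |r'| on (0, R) (`RadialConstraints.abs_κ_lt`).

The Sobolev norms enter through one scale-invariant bound, which is why the smallness constant does
not depend on R: a function f on ℝ³ satisfies ∫_{B(0,ρ)} |f|² ≤ C ρ ∫ |ξ| |f̂|²
(`lintegral_ball_enorm_sq_le`), by splitting frequencies at 1/ρ. Applied to the components of k, to
ψ₁ and to the first derivatives of ψ₀, it gives G(ρ) ≤ δρ with δ small, where G(ρ) is the integral
over (0, ρ) of t² times the energy density (`radial_energy_le`).

In spherical symmetry the momentum constraint reads κ' = r'u - rψ₁ψ₀'/2. Together with the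
Hamiltonian constraint it shows that r(1 - r'² + κ²), twice the Hawking mass, has derivative
r²(r'(ψ₀'² + ψ₁²)/2 - κψ₁ψ₀'), from which u has disappeared. A continuity argument starts from r'(0)
= 1: as long as |r' - 1| ≤ 1/2, the momentum equation and G ≤ δρ give |κ| ≤ 1/4, and then the mass
equation improves the assumption to |r' - 1| ≤ 1/4. The bounds never degenerate, so |κ| ≤ 1/4 < 3/4
≤ r' everywhere.

An invariant embedded surface contains a sphere of positive radius, whose tangent planes and unit
normals are the expected ones; `trapped_sphere` extracts κ < -|r'|, up to a positive factor, from
the trapping condition. -/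

/-! ### Local L² growth of functions with half a derivative in L² -/

open SchwartzMap in
theorem Lp_eq_of_forall_integral_eq {f g : E3 → ℂ} (hf : LocallyIntegrable f volume)
    (hg : LocallyIntegrable g volume)
    (h : ∀ φ : 𝓢(E3, ℂ), ∫ x, φ x • f x = ∫ x, φ x • g x) : f =ᵐ[volume] g := by
  apply ae_eq_of_integral_contDiff_smul_eq hf hg
  intro φ hφ hc
  have h₁ : HasCompactSupport (Complex.ofRealCLM ∘ φ) := hc.comp_left rfl
  have h₂ : ContDiff ℝ ∞ (Complex.ofRealCLM ∘ φ) := by fun_prop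
  simpa using h (h₁.toSchwartzMap h₂)

-- The inverse transform on L² is defined abstractly. Moving it onto a Schwartz test function, in
-- the distributional sense on one side and by Fubini on the other, identifies it with the integral
-- formula on L¹ ∩ L².
open SchwartzMap in
theorem fourierInv_Lp_ae_eq {g : E3 → ℂ} (h2 : MemLp g 2 volume) (h1 : Integrable g volume) :
    (𝓕⁻ (h2.toLp g) : Lp ℂ 2 (volume : Measure E3)) =ᵐ[volume] (𝓕⁻ g : E3 → ℂ) := by
  have hcont : Continuous (𝓕⁻ g : E3 → ℂ) := by
    rw [Real.fourierInv_eq_fourier_comp_neg]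
    exact VectorFourier.fourierIntegral_continuous Real.continuous_fourierChar
      (by exact continuous_inner) h1.comp_neg
  apply Lp_eq_of_forall_integral_eq
  · exact (Lp.memLp _).locallyIntegrable one_le_two
  · exact hcont.locallyIntegrable
  intro φ
  have e := DFunLike.congr_fun (Lp.fourierInv_toTemperedDistribution_eq (h2.toLp g)) φ
  rw [TemperedDistribution.fourierInv_apply, Lp.toTemperedDistribution_apply,
    Lp.toTemperedDistribution_apply] at e
  rw [← e]
  have e2 : ∫ x, (𝓕⁻ φ) x • (h2.toLp g) x = ∫ x, (𝓕⁻ φ) x • g x := by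
    apply integral_congr_ae
    filter_upwards [h2.coeFn_toLp] with x hx
    rw [hx]
  rw [e2]
  have := VectorFourier.integral_fourierIntegral_smul_eq_flip (μ := (volume : Measure E3))
    (ν := (volume : Measure E3)) (L := -(innerₗ E3)) (f := φ) (g := g) Real.continuous_fourierChar
    (by
      have : Continuous fun p : E3 × E3 => -(inner ℝ p.1 p.2) := by fun_prop
      exact this) φ.integrable h1
  refine Eq.trans (integral_congr_ae (.of_forall fun x => ?_))
    (this.trans (integral_congr_ae (.of_forall fun x => ?_)))
  · simp [SchwartzMap.fourierInv_coe, Real.fourierInv_eq, VectorFourier.fourierIntegral]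
  · simp [Real.fourierInv_eq, VectorFourier.fourierIntegral, real_inner_comm]

theorem enorm_fourierInv_Lp_le {g : E3 → ℂ} (h2 : MemLp g 2 volume) (h1 : Integrable g volume) :
    ∀ᵐ x, ‖(𝓕⁻ (h2.toLp g) : Lp ℂ 2 (volume : Measure E3)) x‖ₑ ≤ ∫⁻ ξ, ‖g ξ‖ₑ := by
  filter_upwards [fourierInv_Lp_ae_eq h2 h1] with x hx
  rw [hx, Real.fourierInv_eq]
  refine (enorm_integral_le_lintegral_enorm _).trans (lintegral_mono fun ξ => ?_)
  rw [← ofReal_norm, ← ofReal_norm, Circle.norm_smul]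

theorem lintegral_ball_enorm_inv {M : ℝ} (hM : 0 < M) :
    ∫⁻ ξ in ball (0 : E3) M, ‖ξ‖ₑ⁻¹ =
      ENNReal.ofReal (3 / 2 * volume.real (ball (0 : E3) 1) * M ^ 2) := by
  have key : IntegrableOn (fun y : ℝ => y) (Set.Ioo 0 M) volume :=
    (continuous_id.integrableOn_Icc (a := 0) (b := M)).mono_set Set.Ioo_subset_Icc_self
  have hint : Integrable (fun ξ : E3 => (Set.Iio M).indicator (fun y : ℝ => y⁻¹) ‖ξ‖) volume := by
    rw [integrable_fun_norm_addHaar volume (f := (Set.Iio M).indicator (fun y : ℝ => y⁻¹))]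
    have : IntegrableOn ((Set.Iio M).indicator fun y : ℝ => y) (Set.Ioi 0) volume := by
      rw [integrableOn_indicator_iff measurableSet_Iio, Set.inter_comm, Set.Ioi_inter_Iio]
      exact key
    refine this.congr_fun (fun y (hy : 0 < y) => ?_) measurableSet_Ioi
    by_cases h : y < M
    · simp [h]; field_simp
    · simp [h]
  have hval := integral_fun_norm_addHaar (volume : Measure E3)
    ((Set.Iio M).indicator (fun y : ℝ => y⁻¹))
  have h2 : ∫ y in Set.Ioi (0 : ℝ), y ^ (Module.finrank ℝ E3 - 1) •
      (Set.Iio M).indicator (fun y : ℝ => y⁻¹) y = M ^ 2 / 2 := by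
    have : ∫ y in Set.Ioi (0 : ℝ), y ^ (Module.finrank ℝ E3 - 1) •
      (Set.Iio M).indicator (fun y : ℝ => y⁻¹) y =
      ∫ y in Set.Ioi (0 : ℝ), (Set.Iio M).indicator (fun y : ℝ => y) y := by
      refine setIntegral_congr_fun measurableSet_Ioi fun y (hy : 0 < y) => ?_
      by_cases h : y < M
      · simp [h]; field_simp
      · simp [h]
    rw [this, setIntegral_indicator measurableSet_Iio, Set.Ioi_inter_Iio,
      ← integral_Ioc_eq_integral_Ioo, ← intervalIntegral.integral_of_le hM.le]
    simp
  rw [h2] at hval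
  have hnn : 0 ≤ᵐ[volume] fun ξ : E3 => (Set.Iio M).indicator (fun y : ℝ => y⁻¹) ‖ξ‖ :=
    .of_forall fun ξ => Set.indicator_apply_nonneg fun _ => by simp
  have h3 := ofReal_integral_eq_lintegral_ofReal hint hnn
  rw [hval] at h3
  rw [← lintegral_indicator measurableSet_ball]
  have h4 : ∀ᵐ ξ : E3, ξ ≠ 0 := by
    simp [ae_iff]
  rw [show 3 / 2 * volume.real (ball (0 : E3) 1) * M ^ 2 = (Module.finrank ℝ E3) •
    volume.real (ball (0 : E3) 1) • (M ^ 2 / 2) by simp; ring, h3]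
  apply lintegral_congr_ae
  filter_upwards [h4] with ξ hξ
  by_cases h : ‖ξ‖ < M
  · simp [h, ENNReal.ofReal_inv_of_pos, hξ]
  · simp [h]

theorem lintegral_enorm_sq_Lp (F : Lp ℂ 2 (volume : Measure E3)) :
    ∫⁻ x, ‖F x‖ₑ ^ 2 = ‖F‖ₑ ^ 2 := by
  have := eLpNorm_nnreal_pow_eq_lintegral (f := F) (μ := (volume : Measure E3)) (p := 2) two_ne_zero
  rw [Lp.enorm_def]
  simpa using this.symm

theorem lintegral_enorm_sq_fourierInv {g : E3 → ℂ} (h2 : MemLp g 2 volume) :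
    ∫⁻ x, ‖(𝓕⁻ (h2.toLp g) : Lp ℂ 2 (volume : Measure E3)) x‖ₑ ^ 2 = ∫⁻ x, ‖g x‖ₑ ^ 2 := by
  have h : ‖(𝓕⁻ (h2.toLp g) : Lp ℂ 2 (volume : Measure E3))‖ = ‖h2.toLp g‖ := by
    rw [← Lp.norm_fourier_eq, FourierTransform.fourier_fourierInv_eq]
  have h' : ‖(𝓕⁻ (h2.toLp g) : Lp ℂ 2 (volume : Measure E3))‖ₑ = ‖h2.toLp g‖ₑ := by
    rw [← ofReal_norm, ← ofReal_norm, h]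
  rw [lintegral_enorm_sq_Lp, h', ← lintegral_enorm_sq_Lp]
  apply lintegral_congr_ae
  filter_upwards [h2.coeFn_toLp] with x hx
  rw [hx]

/-- The constant of the local `L²` bound for functions in `H^{1/2}(ℝ³)`. -/
noncomputable def morreyConst : ℝ := 3 * volume.real (ball (0 : E3) 1) ^ 2 + 2

theorem morreyConst_pos : 0 < morreyConst := by
  unfold morreyConst; positivity

/-- Cauchy–Schwarz with the weights |ξ|^(-1/2) and |ξ|^(1/2); in dimension three |ξ|⁻¹ is locally
integrable, with integral of order M² over the ball of radius M. -/
theorem sq_lintegral_ball_enorm_le {h : E3 → ℂ} (hh : AEStronglyMeasurable h volume) {M : ℝ}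
    (hM : 0 < M) :
    (∫⁻ ξ in ball (0 : E3) M, ‖h ξ‖ₑ) ^ 2 ≤
      ENNReal.ofReal (3 / 2 * volume.real (ball (0 : E3) 1) * M ^ 2) *
        ∫⁻ ξ, ‖ξ‖ₑ * ‖h ξ‖ₑ ^ 2 := by
  have hne : ∀ᵐ ξ : E3, ξ ≠ 0 := by simp [ae_iff]
  have hm1 : AEMeasurable (fun ξ : E3 => ‖ξ‖ₑ ^ (-(1 / 2) : ℝ)) (volume.restrict (ball 0 M)) := by
    fun_prop
  have hm2 : AEMeasurable (fun ξ : E3 => ‖ξ‖ₑ ^ (1 / 2 : ℝ) * ‖h ξ‖ₑ)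
      (volume.restrict (ball 0 M)) := by
    have := hh.enorm.mono_measure (μ := volume) (ν := volume.restrict (ball 0 M))
      Measure.restrict_le_self
    fun_prop
  have hcs := ENNReal.lintegral_mul_le_Lp_mul_Lq (volume.restrict (ball (0 : E3) M))
    Real.HolderConjugate.two_two hm1 hm2
  have e1 : ∫⁻ ξ in ball (0 : E3) M, ‖h ξ‖ₑ =
      ∫⁻ ξ in ball (0 : E3) M, ((fun ξ : E3 => ‖ξ‖ₑ ^ (-(1 / 2) : ℝ)) *
        fun ξ : E3 => ‖ξ‖ₑ ^ (1 / 2 : ℝ) * ‖h ξ‖ₑ) ξ := by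
    apply lintegral_congr_ae
    filter_upwards [ae_restrict_of_ae hne] with ξ hξ
    have h0 : ‖ξ‖ₑ ≠ 0 := by simpa using hξ
    simp only [Pi.mul_apply]
    rw [← mul_assoc, ← ENNReal.rpow_add _ _ h0 (by simp)]
    simp
  rw [← e1] at hcs
  have sq (a : ℝ≥0∞) : (a ^ (1 / 2 : ℝ)) ^ 2 = a := by
    rw [← ENNReal.rpow_natCast, ← ENNReal.rpow_mul]; simp
  refine (pow_le_pow_left' hcs 2).trans ?_
  rw [mul_pow, sq, sq, ← lintegral_ball_enorm_inv hM]
  refine mul_le_mul' (le_of_eq ?_) ?_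
  · refine lintegral_congr fun ξ => ?_
    rw [← ENNReal.rpow_mul, ← ENNReal.rpow_neg_one]
    norm_num
  · refine (setLIntegral_le_lintegral _ _).trans (le_of_eq (lintegral_congr fun ξ => ?_))
    rw [ENNReal.rpow_two, mul_pow, sq]

/-- Split the frequencies at 1/ρ. The low part is bounded pointwise by the L¹ norm of its transform,
with square at most a constant times ρ⁻²A, and the ball has volume of order ρ³. The high part is
controlled by Plancherel, because ρ|ξ| ≥ 1 there. Both contributions are of order ρA. -/
theorem lintegral_ball_enorm_sq_le (f : Lp ℂ 2 (volume : Measure E3)) {ρ : ℝ} (hρ : 0 < ρ) :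
    ∫⁻ x in ball (0 : E3) ρ, ‖f x‖ₑ ^ 2 ≤ ENNReal.ofReal (morreyConst * ρ) *
      ∫⁻ ξ, ‖ξ‖ₑ * ‖(𝓕 f : Lp ℂ 2 (volume : Measure E3)) ξ‖ₑ ^ 2 := by
  set h : Lp ℂ 2 (volume : Measure E3) := 𝓕 f with hdef
  set A := ∫⁻ ξ, ‖ξ‖ₑ * ‖h ξ‖ₑ ^ 2 with hA
  set V := volume.real (ball (0 : E3) 1)
  have hV : 0 ≤ V := measureReal_nonneg
  have m1 : MemLp ((ball (0 : E3) ρ⁻¹).indicator h) 2 volume :=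
    (Lp.memLp h).indicator measurableSet_ball
  have m2 : MemLp ((ball (0 : E3) ρ⁻¹)ᶜ.indicator h) 2 volume :=
    (Lp.memLp h).indicator measurableSet_ball.compl
  have i1 : Integrable ((ball (0 : E3) ρ⁻¹).indicator h) volume := by
    rw [integrable_indicator_iff measurableSet_ball]
    have : IsFiniteMeasure (volume.restrict (ball (0 : E3) ρ⁻¹)) :=
      ⟨by rw [Measure.restrict_apply_univ]; exact measure_ball_lt_top⟩
    exact ((Lp.memLp h).restrict _).integrable one_le_two
  have hsum : f = 𝓕⁻ (m1.toLp _) + 𝓕⁻ (m2.toLp _) := by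
    rw [← FourierTransform.fourierInv_add, ← MemLp.toLp_add]
    have : (m1.add m2).toLp _ = h := by
      refine Eq.trans ?_ (Lp.toLp_coeFn h (Lp.memLp h))
      apply MemLp.toLp_congr
      rw [Set.indicator_self_add_compl]
    rw [this, hdef, FourierTransform.fourierInv_fourier_eq]
  have hlow : ∀ᵐ x, ‖(𝓕⁻ (m1.toLp _) : Lp ℂ 2 (volume : Measure E3)) x‖ₑ ^ 2 ≤
      ENNReal.ofReal (3 / 2 * V * ρ⁻¹ ^ 2) * A := by
    filter_upwards [enorm_fourierInv_Lp_le m1 i1] with x hx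
    refine (pow_le_pow_left' hx 2).trans ?_
    have := sq_lintegral_ball_enorm_le (Lp.aestronglyMeasurable h) (inv_pos.2 hρ)
    rwa [← lintegral_indicator measurableSet_ball, lintegral_congr fun ξ =>
      show (ball (0 : E3) ρ⁻¹).indicator (fun ξ => ‖h ξ‖ₑ) ξ =
        ‖(ball (0 : E3) ρ⁻¹).indicator h ξ‖ₑ by
        rw [enorm_indicator_eq_indicator_enorm]] at this
  have hhigh : ∫⁻ x, ‖(𝓕⁻ (m2.toLp _) : Lp ℂ 2 (volume : Measure E3)) x‖ₑ ^ 2 ≤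
      ENNReal.ofReal ρ * A := by
    rw [lintegral_enorm_sq_fourierInv m2, hA, ← lintegral_const_mul' _ _ ENNReal.ofReal_ne_top]
    refine lintegral_mono fun ξ => ?_
    by_cases hξ : ξ ∈ ball (0 : E3) ρ⁻¹
    · simp [hξ]
    · rw [Set.indicator_of_mem (show ξ ∈ (ball (0 : E3) ρ⁻¹)ᶜ from hξ), ← mul_assoc]
      have h1 : ρ⁻¹ ≤ ‖ξ‖ := by simpa using hξ
      have h2 : 1 ≤ ENNReal.ofReal ρ * ‖ξ‖ₑ := by
        rw [← ofReal_norm, ← ENNReal.ofReal_mul hρ.le, ENNReal.one_le_ofReal]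
        calc 1 = ρ * ρ⁻¹ := by field_simp
          _ ≤ _ := by gcongr
      exact le_mul_of_one_le_left' h2
  have hvol : volume (ball (0 : E3) ρ) = ENNReal.ofReal (ρ ^ 3 * V) := by
    rw [Measure.addHaar_ball _ _ hρ.le, ENNReal.ofReal_mul (by positivity),
      ofReal_measureReal]
    simp
  calc ∫⁻ x in ball (0 : E3) ρ, ‖f x‖ₑ ^ 2
      ≤ ∫⁻ x in ball (0 : E3) ρ, 2 * (ENNReal.ofReal (3 / 2 * V * ρ⁻¹ ^ 2) * A +
          ‖(𝓕⁻ (m2.toLp _) : Lp ℂ 2 (volume : Measure E3)) x‖ₑ ^ 2) := by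
        apply lintegral_mono_ae
        refine ae_restrict_of_ae ?_
        filter_upwards [hlow, Lp.coeFn_add (𝓕⁻ (m1.toLp _)) (𝓕⁻ (m2.toLp _))] with x hx hx'
        rw [← hsum] at hx'
        rw [hx', Pi.add_apply]
        refine (pow_le_pow_left' (enorm_add_le _ _) 2).trans ?_
        have := ENNReal.rpow_add_le_mul_rpow_add_rpow
          ‖(𝓕⁻ (m1.toLp _) : Lp ℂ 2 (volume : Measure E3)) x‖ₑ
          ‖(𝓕⁻ (m2.toLp _) : Lp ℂ 2 (volume : Measure E3)) x‖ₑ one_le_two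
        norm_num at this
        refine this.trans ?_
        gcongr
    _ ≤ 2 * (ENNReal.ofReal (3 / 2 * V * ρ⁻¹ ^ 2) * A * ENNReal.ofReal (ρ ^ 3 * V) +
          ENNReal.ofReal ρ * A) := by
        rw [lintegral_const_mul' _ _ (by simp), lintegral_add_left measurable_const,
          setLIntegral_const, hvol]
        gcongr
        exact (setLIntegral_le_lintegral _ _).trans hhigh
    _ = ENNReal.ofReal (morreyConst * ρ) * A := by
        have : morreyConst * ρ = 2 * (3 / 2 * V * ρ⁻¹ ^ 2 * (ρ ^ 3 * V) + ρ) := by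
          unfold morreyConst; field_simp; ring
        rw [this, ENNReal.ofReal_mul zero_le_two, ENNReal.ofReal_add (by positivity) hρ.le,
          ENNReal.ofReal_mul (p := 3 / 2 * V * ρ⁻¹ ^ 2) (by positivity), ENNReal.ofReal_ofNat]
        ring

/-! ### From Sobolev norms on the ball to growth bounds for functions and gradients -/

theorem exists_memLp_of_sobolevNormOn_lt {s : ℝ} {Ω : Set E3} {f : E3 → ℝ} {M : ℝ≥0∞}
    (h : sobolevNormOn s Ω f < M) :
    ∃ (F : E3 → ℝ) (hF : MemLp (fun x => (F x : ℂ)) 2 (volume : Measure E3)), Set.EqOn F f Ω ∧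
      ∫⁻ ξ : E3, ENNReal.ofReal ((1 + ‖ξ‖ ^ 2) ^ s) *
        ‖(𝓕 (hF.toLp (fun x => (F x : ℂ))) : Lp ℂ 2 (volume : Measure E3)) ξ‖ₑ ^ 2 ≤ M ^ 2 := by
  unfold sobolevNormOn sobolevNorm at h
  simp only [iInf_lt_iff] at h
  obtain ⟨F, hEq, hF, hlt⟩ := h
  refine ⟨F, hF, hEq, ?_⟩
  have := pow_le_pow_left' hlt.le 2
  rwa [← ENNReal.rpow_natCast, ← ENNReal.rpow_mul, show (1 / 2 : ℝ) * ((2 : ℕ) : ℝ) = 1 by norm_num,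
    ENNReal.rpow_one] at this

theorem le_rpow_one_add_sq (x : ℝ) (hx : 0 ≤ x) (n : ℕ) :
    x ^ n ≤ (1 + x ^ 2) ^ ((n : ℝ) / 2) := by
  have h : x ≤ (1 + x ^ 2) ^ (1 / 2 : ℝ) := by
    rw [← Real.sqrt_eq_rpow]
    exact Real.le_sqrt_of_sq_le (by linarith)
  calc x ^ n ≤ ((1 + x ^ 2) ^ (1 / 2 : ℝ)) ^ n := by gcongr
    _ = _ := by
      rw [← Real.rpow_mul_natCast (by positivity)]; congr 1; ring

theorem lintegral_ball_sq_le_of_sobolevNormOn_lt {R : ℝ} {f : E3 → ℝ} {M : ℝ≥0∞}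
    (h : sobolevNormOn (1 / 2) (ball 0 R) f < M) {ρ : ℝ} (hρ : 0 < ρ) (hρR : ρ ≤ R) :
    ∫⁻ x in ball (0 : E3) ρ, ‖f x‖ₑ ^ 2 ≤ ENNReal.ofReal (morreyConst * ρ) * M ^ 2 := by
  obtain ⟨F, hF, hEq, hM⟩ := exists_memLp_of_sobolevNormOn_lt h
  calc ∫⁻ x in ball (0 : E3) ρ, ‖f x‖ₑ ^ 2
      = ∫⁻ x in ball (0 : E3) ρ, ‖hF.toLp (fun x => (F x : ℂ)) x‖ₑ ^ 2 := by
        apply lintegral_congr_ae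
        filter_upwards [ae_restrict_of_ae hF.coeFn_toLp, ae_restrict_mem measurableSet_ball]
          with x hx hxρ
        rw [hx, ← hEq (ball_subset_ball hρR hxρ)]
        simp [← ofReal_norm]
    _ ≤ _ := lintegral_ball_enorm_sq_le _ hρ
    _ ≤ _ := by
        gcongr
        refine le_trans (lintegral_mono fun ξ => ?_) hM
        gcongr
        rw [← ofReal_norm]
        exact ENNReal.ofReal_le_ofReal (by simpa using le_rpow_one_add_sq ‖ξ‖ (norm_nonneg _) 1)

-- Multiplication by 2πi⟨ξ, m⟩ on the Fourier side is differentiation of tempered distributions, so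
-- `g` is the weak derivative of `f` in the direction `m`.
open SchwartzMap LineDeriv in
theorem integral_smul_eq_neg_of_fourier_eq {f g : Lp ℂ 2 (volume : Measure E3)} {m : E3}
    (h : (𝓕 g : Lp ℂ 2 (volume : Measure E3)) =ᵐ[volume]
      fun ξ => (2 * Real.pi * Complex.I) * (inner ℝ ξ m : ℝ) *
        (𝓕 f : Lp ℂ 2 (volume : Measure E3)) ξ) (φ : 𝓢(E3, ℂ)) :
    ∫ x, φ x • g x = - ∫ x, (∂_{m} φ) x • f x := by
  have key : (g : 𝓢'(E3, ℂ)) = ∂_{m} (f : 𝓢'(E3, ℂ)) := by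
    rw [← FourierTransform.fourierInv_fourier_eq (F := 𝓢'(E3, ℂ)) (g : 𝓢'(E3, ℂ)),
      ← FourierTransform.fourierInv_fourier_eq (F := 𝓢'(E3, ℂ)) (∂_{m} (f : 𝓢'(E3, ℂ)))]
    congr 1
    rw [TemperedDistribution.fourier_lineDerivOp_eq, Lp.fourier_toTemperedDistribution_eq,
      Lp.fourier_toTemperedDistribution_eq]
    ext u
    have ht : (fun x : E3 => (inner ℝ x m : ℝ)).HasTemperateGrowth := by fun_prop
    rw [Lp.toTemperedDistribution_apply]
    simp only [smul_apply, TemperedDistribution.smulLeftCLM_apply_apply,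
      Lp.toTemperedDistribution_apply]
    rw [← integral_smul]
    apply integral_congr_ae
    filter_upwards [h] with ξ hξ
    rw [hξ, SchwartzMap.smulLeftCLM_apply_apply (by fun_prop)]
    simp
    ring
  have := DFunLike.congr_fun key φ
  rw [TemperedDistribution.lineDerivOp_apply_apply, Lp.toTemperedDistribution_apply,
    Lp.toTemperedDistribution_apply] at this
  rw [this, ← integral_neg]
  simp

-- Weak and classical derivatives agree where the function is smooth: test with functions supported
-- in `U` and integrate by parts. What `F` does outside `U` plays no role, as needed for an
-- extension of a function known only on a ball.
open SchwartzMap LineDeriv in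
theorem ae_eq_fderiv_of_integral_smul_eq_neg {F G : E3 → ℂ} {f : E3 → ℝ} {U : Set E3} {m : E3}
    (hU : IsOpen U) (hG : LocallyIntegrable G volume)
    (hf : ContDiffOn ℝ ∞ f U) (hFf : ∀ᵐ x, x ∈ U → F x = f x)
    (h : ∀ φ : 𝓢(E3, ℂ), ∫ x, φ x • G x = - ∫ x, (∂_{m} φ) x • F x) :
    ∀ᵐ x, x ∈ U → G x = (fderiv ℝ f x m : ℝ) := by
  have hc : ContinuousOn (fun x => ((fderiv ℝ f x m : ℝ) : ℂ)) U := by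
    have := (hf.continuousOn_fderiv_of_isOpen hU (by simp)).clm_apply
      (continuousOn_const (c := m))
    exact Complex.continuous_ofReal.comp_continuousOn this
  have hloc : LocallyIntegrableOn (fun x => G x - ((fderiv ℝ f x m : ℝ) : ℂ)) U volume :=
    (hG.locallyIntegrableOn U).sub (hc.locallyIntegrableOn hU.measurableSet)
  have := IsOpen.ae_eq_zero_of_integral_contDiff_smul_eq_zero hU hloc ?_
  · filter_upwards [this] with x hx hxU
    exact sub_eq_zero.1 (hx hxU)
  intro φ hφ hcs hts
  have h₁ : HasCompactSupport (Complex.ofRealCLM ∘ φ) := hcs.comp_left rfl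
  have h₂ : ContDiff ℝ ∞ (Complex.ofRealCLM ∘ φ) := by fun_prop
  have e := h (h₁.toSchwartzMap h₂)
  have hint {u v : E3 → ℝ} (hu : Continuous u) (hus : ∀ x, x ∉ tsupport φ → u x = 0)
      (hv : ContinuousOn v U) : Integrable (fun x => u x * v x) volume := by
    rw [← integrableOn_iff_integrable_of_support_subset (s := tsupport φ)]
    · exact (hu.continuousOn.mul (hv.mono hts)).integrableOn_compact hcs
    · intro x hx
      by_contra hxs
      exact hx (by simp [hus x hxs])
  have hφ0 : ∀ x, x ∉ tsupport φ → φ x = 0 := fun x => image_eq_zero_of_notMem_tsupport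
  have hdφ0 : ∀ x, x ∉ tsupport φ → fderiv ℝ φ x m = 0 := fun x hx => by
    have : fderiv ℝ φ x = 0 := by
      by_contra h0
      exact hx (support_fderiv_subset ℝ h0)
    simp [this]
  have hcφ' : Continuous fun x => fderiv ℝ φ x m :=
    (hφ.continuous_fderiv (by simp)).clm_apply continuous_const
  have hcf' : ContinuousOn (fun x => fderiv ℝ f x m) U :=
    (hf.continuousOn_fderiv_of_isOpen hU (by simp)).clm_apply continuousOn_const
  have hdf : ∀ x ∈ tsupport φ, HasLineDerivAt ℝ f (fderiv ℝ f x m) x m := fun x hx =>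
    ((hf.contDiffAt (hU.mem_nhds (hts hx))).differentiableAt (by simp)).hasFDerivAt.hasLineDerivAt m
  have hdφ : ∀ x ∈ tsupport f, HasLineDerivAt ℝ φ (fderiv ℝ φ x m) x m := fun x _ =>
    ((hφ.contDiffAt (x := x)).differentiableAt (by simp)).hasFDerivAt.hasLineDerivAt m
  have ibp : ∫ x, f x * fderiv ℝ φ x m = - ∫ x, fderiv ℝ f x m * φ x := by
    refine integral_bilinear_hasLineDerivAt_right_eq_neg_left_of_integrable
      (B := ContinuousLinearMap.mul ℝ ℝ) ?_ ?_ ?_ hdf hdφ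
    · simpa [mul_comm] using hint hφ.continuous hφ0 hcf'
    · simpa [mul_comm] using hint hcφ' hdφ0 hf.continuousOn
    · simpa [mul_comm] using hint hφ.continuous hφ0 hf.continuousOn
  have hΦ : ∀ x, (∂_{m} (h₁.toSchwartzMap h₂)) x = ((fderiv ℝ φ x m : ℝ) : ℂ) := fun x => by
    have hd : HasFDerivAt (Complex.ofRealCLM ∘ φ) (Complex.ofRealCLM.comp (fderiv ℝ φ x)) x :=
      Complex.ofRealCLM.hasFDerivAt.comp x
        ((hφ.contDiffAt (x := x)).differentiableAt (by simp)).hasFDerivAt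
    rw [SchwartzMap.lineDerivOp_apply_eq_fderiv]
    have : (⇑(h₁.toSchwartzMap h₂) : E3 → ℂ) = Complex.ofRealCLM ∘ φ := by ext; simp
    rw [this, hd.fderiv]
    simp
  have e1 : ∫ x, (∂_{m} (h₁.toSchwartzMap h₂)) x • F x =
      ((∫ x, f x * fderiv ℝ φ x m : ℝ) : ℂ) := by
    rw [← integral_complex_ofReal]
    apply integral_congr_ae
    filter_upwards [hFf] with x hx
    rw [hΦ]
    by_cases hxs : x ∈ tsupport φ
    · rw [hx (hts hxs)]; simp [mul_comm]
    · simp [hdφ0 x hxs]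
  have e2 : ∫ x, φ x • (((fderiv ℝ f x m : ℝ) : ℂ)) =
      ((∫ x, fderiv ℝ f x m * φ x : ℝ) : ℂ) := by
    rw [← integral_complex_ofReal]
    congr 1; ext x; simp [mul_comm]
  rw [e1, ibp] at e
  have e3 : ∫ x, φ x • G x = ((∫ x, fderiv ℝ f x m * φ x : ℝ) : ℂ) := by
    simpa using e
  simp only [smul_sub]
  rw [integral_sub, e3, e2, sub_self]
  · exact hG.integrable_smul_left_of_hasCompactSupport hφ.continuous hcs
  · simpa [mul_comm] using (hint hφ.continuous hφ0 hcf').ofReal (𝕜 := ℂ)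

/-- Of the weight (1 + |ξ|²)^(3/2), a factor |ξ|² pays for the derivative and the remaining |ξ| for
the growth bound. The factor (2π)² comes from the normalization of the transform. -/
theorem lintegral_ball_pd_sq_le_of_sobolevNormOn_lt {R : ℝ} {f : E3 → ℝ} {M : ℝ≥0∞}
    (h : sobolevNormOn (3 / 2) (ball 0 R) f < M) (hf : ContDiffOn ℝ ∞ f (ball 0 R)) (i : Fin 3)
    {ρ : ℝ} (hρ : 0 < ρ) (hρR : ρ ≤ R) :
    ∫⁻ x in ball (0 : E3) ρ, ‖pd i f x‖ₑ ^ 2 ≤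
      ENNReal.ofReal (morreyConst * ρ) * (ENNReal.ofReal ((2 * Real.pi) ^ 2) * M ^ 2) := by
  rcases eq_or_ne M ⊤ with rfl | hMtop
  · have := morreyConst_pos
    rw [ENNReal.top_pow two_ne_zero, ENNReal.mul_top, ENNReal.mul_top]
    · exact le_top
    · simp; positivity
    · simp
  obtain ⟨F, hF, hEq, hM⟩ := exists_memLp_of_sobolevNormOn_lt h
  set Fh : Lp ℂ 2 (volume : Measure E3) := 𝓕 (hF.toLp (fun x => (F x : ℂ)))
  set m : E3 := EuclideanSpace.single i 1
  let gh : E3 → ℂ := fun ξ => (2 * Real.pi * Complex.I) * (inner ℝ ξ m : ℝ) * Fh ξ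
  have hnorm : ∀ ξ, ‖gh ξ‖ₑ ^ 2 ≤ ENNReal.ofReal ((2 * Real.pi) ^ 2) *
      (ENNReal.ofReal (‖ξ‖ ^ 2) * ‖Fh ξ‖ₑ ^ 2) := fun ξ => by
    have h1 : ‖gh ξ‖ ≤ 2 * Real.pi * ‖ξ‖ * ‖Fh ξ‖ := by
      have : |inner ℝ ξ m| ≤ ‖ξ‖ := by
        simpa [m] using abs_real_inner_le_norm ξ m
      simp only [gh, norm_mul, Complex.norm_real, Complex.norm_I, Real.norm_eq_abs,
        Complex.norm_ofNat, mul_one, abs_of_pos Real.pi_pos]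
      gcongr
    rw [← ofReal_norm, ← ofReal_norm, ← ENNReal.ofReal_pow (by positivity),
      ← ENNReal.ofReal_pow (by positivity), ← ENNReal.ofReal_mul (by positivity),
      ← ENNReal.ofReal_mul (by positivity)]
    refine ENNReal.ofReal_le_ofReal ?_
    calc ‖gh ξ‖ ^ 2 ≤ (2 * Real.pi * ‖ξ‖ * ‖Fh ξ‖) ^ 2 := by gcongr
      _ = _ := by ring
  have hmeas : AEStronglyMeasurable gh volume := by
    have : Continuous fun ξ : E3 => (2 * Real.pi * Complex.I) * ((inner ℝ ξ m : ℝ) : ℂ) := by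
      fun_prop
    exact this.aestronglyMeasurable.mul (Lp.aestronglyMeasurable Fh)
  have hpow (n : ℕ) (hn : n ≤ 3) (ξ : E3) :
      ENNReal.ofReal (‖ξ‖ ^ n) ≤ ENNReal.ofReal ((1 + ‖ξ‖ ^ 2) ^ (3 / 2 : ℝ)) := by
    refine ENNReal.ofReal_le_ofReal ((le_rpow_one_add_sq ‖ξ‖ (norm_nonneg _) n).trans ?_)
    apply Real.rpow_le_rpow_of_exponent_le
    · nlinarith [sq_nonneg ‖ξ‖]
    · have : (n : ℝ) ≤ 3 := by exact_mod_cast hn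
      linarith
  have hgh : MemLp gh 2 volume := by
    refine ⟨hmeas, ?_⟩
    have h2 := eLpNorm_nnreal_pow_eq_lintegral (f := gh) (μ := (volume : Measure E3)) (p := 2)
      two_ne_zero
    have h3 : ∫⁻ ξ, ‖gh ξ‖ₑ ^ 2 < ⊤ := by
      refine lt_of_le_of_lt (lintegral_mono hnorm) ?_
      rw [lintegral_const_mul' _ _ ENNReal.ofReal_ne_top]
      refine ENNReal.mul_lt_top ENNReal.ofReal_lt_top (lt_of_le_of_lt (le_trans
        (lintegral_mono fun ξ => ?_) hM) (by simpa using hMtop.lt_top))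
      exact mul_le_mul_left (hpow 2 (by norm_num) ξ) _
    have h4 : eLpNorm gh 2 volume ^ 2 < ⊤ := by
      have : eLpNorm gh 2 volume ^ 2 = ∫⁻ ξ, ‖gh ξ‖ₑ ^ 2 := by simpa using h2
      rwa [this]
    simpa using h4
  -- The weak derivative of the whole extension is built on the Fourier side and only afterwards
  -- compared with the classical derivative inside the ball.
  set G : Lp ℂ 2 (volume : Measure E3) := 𝓕⁻ (hgh.toLp gh) with hGdef
  have hFG : (𝓕 G : Lp ℂ 2 (volume : Measure E3)) =ᵐ[volume] gh := by
    rw [hGdef, FourierTransform.fourier_fourierInv_eq]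
    exact hgh.coeFn_toLp
  have hae := ae_eq_fderiv_of_integral_smul_eq_neg (F := hF.toLp (fun x => (F x : ℂ))) (G := G)
    (m := m) isOpen_ball
    ((Lp.memLp _).locallyIntegrable one_le_two) hf
    (by
      filter_upwards [hF.coeFn_toLp] with x hx hxU
      rw [hx, hEq hxU])
    (integral_smul_eq_neg_of_fourier_eq hFG)
  calc ∫⁻ x in ball (0 : E3) ρ, ‖pd i f x‖ₑ ^ 2
      = ∫⁻ x in ball (0 : E3) ρ, ‖G x‖ₑ ^ 2 := by
        apply lintegral_congr_ae
        filter_upwards [ae_restrict_of_ae hae, ae_restrict_mem measurableSet_ball]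
          with x hx hxρ
        rw [hx (ball_subset_ball hρR hxρ), pd]
        simp [← ofReal_norm, m]
    _ ≤ _ := lintegral_ball_enorm_sq_le _ hρ
    _ ≤ _ := by
        gcongr
        calc ∫⁻ ξ, ‖ξ‖ₑ * ‖(𝓕 G : Lp ℂ 2 (volume : Measure E3)) ξ‖ₑ ^ 2
            ≤ ∫⁻ ξ, ENNReal.ofReal ((2 * Real.pi) ^ 2) *
              (ENNReal.ofReal ((1 + ‖ξ‖ ^ 2) ^ (3 / 2 : ℝ)) * ‖Fh ξ‖ₑ ^ 2) := by
              apply lintegral_mono_ae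
              filter_upwards [hFG] with ξ hξ
              rw [hξ]
              calc ‖ξ‖ₑ * ‖gh ξ‖ₑ ^ 2 ≤ ‖ξ‖ₑ * (ENNReal.ofReal ((2 * Real.pi) ^ 2) *
                    (ENNReal.ofReal (‖ξ‖ ^ 2) * ‖Fh ξ‖ₑ ^ 2)) := by gcongr; exact hnorm ξ
                _ = ENNReal.ofReal ((2 * Real.pi) ^ 2) *
                    (ENNReal.ofReal (‖ξ‖ ^ 3) * ‖Fh ξ‖ₑ ^ 2) := by
                  rw [pow_succ' ‖ξ‖ 2, ENNReal.ofReal_mul (norm_nonneg _), ofReal_norm]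
                  ring
                _ ≤ _ := by
                  exact mul_le_mul' le_rfl (mul_le_mul' (hpow 3 le_rfl ξ) le_rfl)
          _ = ENNReal.ofReal ((2 * Real.pi) ^ 2) * ∫⁻ ξ,
              (ENNReal.ofReal ((1 + ‖ξ‖ ^ 2) ^ (3 / 2 : ℝ)) * ‖Fh ξ‖ₑ ^ 2) :=
              lintegral_const_mul' _ _ ENNReal.ofReal_ne_top
          _ ≤ _ := by gcongr

/-! ### Derivatives and Christoffel symbols of radial tensors -/

theorem hasFDerivAt_radial {f : ℝ → ℝ} {f' : ℝ} {y : E3} (hy : y ≠ 0)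
    (hf : HasDerivAt f f' ‖y‖) :
    HasFDerivAt (fun z : E3 => f ‖z‖) ((f' / ‖y‖) • innerSL ℝ y) y := by
  have h1 : HasFDerivAt (fun z : E3 => ‖z‖) (‖y‖⁻¹ • innerSL ℝ y) y := by
    have h2 : HasFDerivAt (fun z : E3 => √(‖z‖ ^ 2)) _ y :=
      (hasStrictFDerivAt_norm_sq y).hasFDerivAt.sqrt (by simpa using hy)
    simp only [Real.sqrt_sq (norm_nonneg _)] at h2
    refine h2.congr_fderiv ?_
    ext v
    simp only [one_div, smul_apply, smul_eq_mul, nsmul_eq_mul]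
    push_cast
    field_simp
  refine (hf.comp_hasFDerivAt y h1).congr_fderiv ?_
  rw [smul_smul, div_eq_mul_inv]

theorem hasFDerivAt_coord (i : Fin 3) (y : E3) :
    HasFDerivAt (fun z : E3 => z i) (EuclideanSpace.proj i : E3 →L[ℝ] ℝ) y :=
  (EuclideanSpace.proj i : E3 →L[ℝ] ℝ).hasFDerivAt

theorem pd_eq_of_hasFDerivAt {f F : E3 → ℝ} {L : E3 →L[ℝ] ℝ} {y : E3} (h : HasFDerivAt f L y)
    (hF : F =ᶠ[𝓝 y] f) (m : Fin 3) : pd m F y = L (EuclideanSpace.single m 1) := by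
  rw [pd, hF.fderiv_eq, h.fderiv]

theorem pd_radial {f : ℝ → ℝ} {f' : ℝ} {F : E3 → ℝ} {y : E3} (hy : y ≠ 0)
    (hf : HasDerivAt f f' ‖y‖) (hF : F =ᶠ[𝓝 y] fun z => f ‖z‖) (m : Fin 3) :
    pd m F y = f' / ‖y‖ * y m := by
  rw [pd_eq_of_hasFDerivAt (hasFDerivAt_radial hy hf) hF]
  simp [EuclideanSpace.inner_single_right]

/-- The Kronecker symbol. -/
def kron (i j : Fin 3) : ℝ := if i = j then 1 else 0

theorem single_apply_eq_kron (m i : Fin 3) :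
    (EuclideanSpace.single m (1 : ℝ) : E3) i = kron m i := by
  simp [kron, eq_comm]

theorem proj_single_eq_kron (m i : Fin 3) :
    (EuclideanSpace.proj i : E3 →L[ℝ] ℝ) (EuclideanSpace.single m 1) = kron m i :=
  single_apply_eq_kron m i

theorem innerSL_single (m : Fin 3) (y : E3) :
    innerSL ℝ y (EuclideanSpace.single m 1) = y m := by
  simp [EuclideanSpace.inner_single_right]

theorem kron_comm (i j : Fin 3) : kron i j = kron j i := by
  simp [kron, eq_comm]

theorem sum_kron_mul (i : Fin 3) (X : Fin 3 → ℝ) : ∑ m, kron i m * X m = X i := by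
  simp [kron]

theorem pd_radial_quadratic {a b : ℝ → ℝ} {a' b' c : ℝ} {F : E3 → ℝ} {y : E3} (hy : y ≠ 0)
    (ha : HasDerivAt a a' ‖y‖) (hb : HasDerivAt b b' ‖y‖) {i j : Fin 3}
    (hF : F =ᶠ[𝓝 y] fun z => a ‖z‖ * c + b ‖z‖ * (z i * z j)) (m : Fin 3) :
    pd m F y = a' / ‖y‖ * y m * c + b' / ‖y‖ * y m * (y i * y j) +
      b ‖y‖ * (kron m i * y j + kron m j * y i) := by
  have h := ((hasFDerivAt_radial hy ha).mul_const c).add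
    ((hasFDerivAt_radial hy hb).mul ((hasFDerivAt_coord i y).mul (hasFDerivAt_coord j y)))
  rw [pd_eq_of_hasFDerivAt h hF]
  simp only [add_apply, smul_apply, proj_single_eq_kron, innerSL_single, smul_eq_mul, Pi.mul_apply]
  ring

theorem pd_radial_cubic {P Q W : ℝ → ℝ} {P' Q' W' : ℝ} {F : E3 → ℝ} {y : E3} (hy : y ≠ 0)
    (hP : HasDerivAt P P' ‖y‖) (hQ : HasDerivAt Q Q' ‖y‖) (hW : HasDerivAt W W' ‖y‖)
    {l i j : Fin 3}
    (hF : F =ᶠ[𝓝 y] fun z => P ‖z‖ * (z i * kron j l + z j * kron i l) + Q ‖z‖ * (z l * kron i j) +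
      W ‖z‖ * (z l * (z i * z j))) (m : Fin 3) :
    pd m F y = P' / ‖y‖ * y m * (y i * kron j l + y j * kron i l) +
      P ‖y‖ * (kron m i * kron j l + kron m j * kron i l) +
      Q' / ‖y‖ * y m * (y l * kron i j) + Q ‖y‖ * (kron m l * kron i j) +
      W' / ‖y‖ * y m * (y l * (y i * y j)) +
      W ‖y‖ * (kron m l * (y i * y j) + kron m i * (y l * y j) + kron m j * (y l * y i)) := by
  have h := (((hasFDerivAt_radial hy hP).mul
      (((hasFDerivAt_coord i y).mul_const (kron j l)).add
        ((hasFDerivAt_coord j y).mul_const (kron i l)))).add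
    ((hasFDerivAt_radial hy hQ).mul ((hasFDerivAt_coord l y).mul_const (kron i j)))).add
    ((hasFDerivAt_radial hy hW).mul
      ((hasFDerivAt_coord l y).mul ((hasFDerivAt_coord i y).mul (hasFDerivAt_coord j y))))
  rw [pd_eq_of_hasFDerivAt h hF]
  simp only [add_apply, smul_apply, proj_single_eq_kron, innerSL_single, smul_eq_mul, Pi.add_apply,
    Pi.mul_apply]
  ring

theorem norm_sq_eq_sum_mul (y : E3) : ∑ m, y m * y m = ‖y‖ ^ 2 := by
  rw [EuclideanSpace.real_norm_sq_eq]
  exact Finset.sum_congr rfl fun i _ => by ring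

/-- A rank-one perturbation of a multiple of the identity is inverted explicitly. The condition
`hab` says that the radial direction has unit length. -/
theorem inv_radial_matrix {A : Matrix (Fin 3) (Fin 3) ℝ} {a b : ℝ} {y : E3} (ha : a ≠ 0)
    (hab : a + b * ‖y‖ ^ 2 = 1) (hA : ∀ i j, A i j = a * kron i j + b * (y i * y j)) (i j : Fin 3) :
    A⁻¹ i j = a⁻¹ * kron i j - b / a * (y i * y j) := by
  have : A * Matrix.of (fun i j => a⁻¹ * kron i j - b / a * (y i * y j)) = 1 := by
    ext i j
    rw [Matrix.mul_apply]
    have e : ∀ m, A i m * Matrix.of (fun i j => a⁻¹ * kron i j - b / a * (y i * y j)) m j =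
        kron i m * kron j m - kron i m * (b * (y m * y j)) + kron j m * (b / a * (y i * y m)) -
          b ^ 2 / a * (y i * y j) * (y m * y m) := fun m => by
      rw [hA, Matrix.of_apply, kron_comm m j]
      field_simp
      ring
    rw [Finset.sum_congr rfl fun m _ => e m, Finset.sum_sub_distrib, Finset.sum_add_distrib,
      Finset.sum_sub_distrib, sum_kron_mul, sum_kron_mul, sum_kron_mul, ← Finset.mul_sum,
      norm_sq_eq_sum_mul, Matrix.one_apply, kron_comm j i]
    have : (if i = j then (1 : ℝ) else 0) = kron i j := rfl
    rw [this]
    field_simp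
    linear_combination (-b * y i * y j) * hab
  rw [Matrix.inv_eq_right_inv this, Matrix.of_apply]

/-- `T` is the tensor `u(ρ) dρ² + ρ² a(ρ) dΩ²` near the point `y`. -/
def IsRadialTensorNear (T : Tensor2) (u a : ℝ → ℝ) (y : E3) : Prop :=
  ∀ᶠ z in 𝓝 y, z ≠ 0 ∧ ∀ i j, T z i j = a ‖z‖ * kron i j + (u ‖z‖ - a ‖z‖) / ‖z‖ ^ 2 * (z i * z j)

theorem christoffel_radial {g : Tensor2} {α : ℝ → ℝ} {α' : ℝ} {y : E3}
    (hg : IsRadialTensorNear g (fun _ => 1) α y) (h0 : α ‖y‖ ≠ 0) (hα : HasDerivAt α α' ‖y‖)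
    (l i j : Fin 3) :
    christoffel g l i j y =
      α' / (2 * ‖y‖ * α ‖y‖) * (y i * kron j l + y j * kron i l) +
      ((1 - α ‖y‖) / ‖y‖ ^ 2 - α' / (2 * ‖y‖)) * (y l * kron i j) +
      ((-α' * ‖y‖ - 2 * (1 - α ‖y‖)) / (2 * ‖y‖ ^ 4) -
        α' * (1 - α ‖y‖) / (‖y‖ ^ 3 * α ‖y‖)) * (y l * (y i * y j)) := by
  have hy : y ≠ 0 := hg.self_of_nhds.1
  have hn : ‖y‖ ≠ 0 := by simpa using hy
  set n := ‖y‖ with hndef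
  have hβ : HasDerivAt (fun t => (1 - α t) / t ^ 2) ((-α' * n - 2 * (1 - α n)) / n ^ 3) n := by
    refine (((hasDerivAt_const n (1 : ℝ)).sub hα).div (hasDerivAt_pow 2 n)
      (by positivity)).congr_deriv ?_
    simp only [Pi.sub_apply]
    field_simp
    push_cast
    ring
  have hpd (m i j : Fin 3) : pd m (fun z => g z i j) y = _ :=
    pd_radial_quadratic hy hα hβ (c := kron i j) (i := i) (j := j) (hg.mono fun z hz => hz.2 i j) m
  have hinv := inv_radial_matrix (A := g y) (y := y) h0 (b := (1 - α n) / n ^ 2)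
    (by rw [← hndef]; field_simp; ring) (hg.self_of_nhds.2)
  have e : ∀ m, (g y)⁻¹ l m * (pd i (fun z => g z j m) y + pd j (fun z => g z i m) y -
        pd m (fun z => g z i j) y) =
      (α n)⁻¹ * (kron l m * (α' / n * (y i * kron j m + y j * kron i m - y m * kron i j) +
          (-α' * n - 2 * (1 - α n)) / n ^ 4 * (y i * y j * y m) +
          2 * (1 - α n) / n ^ 2 * (y m * kron i j))) -
      (1 - α n) / n ^ 2 / α n * y l * (α' / n * (y i * (kron j m * y m) + y j * (kron i m * y m)) +
        (2 * (1 - α n) / n ^ 2 * kron i j - α' / n * kron i j +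
          (-α' * n - 2 * (1 - α n)) / n ^ 4 * (y i * y j)) * (y m * y m)) := fun m => by
    rw [hinv, hpd, hpd, hpd, ← hndef, kron_comm j i, kron_comm m i, kron_comm m j]
    field_simp
    ring
  rw [christoffel, Finset.sum_congr rfl fun m _ => e m, Finset.sum_sub_distrib, ← Finset.mul_sum,
    ← Finset.mul_sum, sum_kron_mul, Finset.sum_add_distrib, ← Finset.mul_sum, Finset.sum_add_distrib,
    ← Finset.mul_sum, ← Finset.mul_sum, ← Finset.mul_sum, sum_kron_mul, sum_kron_mul,
    norm_sq_eq_sum_mul, ← hndef]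
  field_simp
  ring

/-- `W'` can stay unspecified: it multiplies a totally symmetric product of coordinates, and its
contributions to the two derivative terms of the Ricci tensor cancel. -/
theorem pd_christoffel_radial {g : Tensor2} {α α₁ : ℝ → ℝ} {α₂ : ℝ} {y : E3}
    (hg : IsRadialTensorNear g (fun _ => 1) α y)
    (hα : ∀ᶠ t in 𝓝 ‖y‖, α t ≠ 0 ∧ HasDerivAt α (α₁ t) t) (hα₁ : HasDerivAt α₁ α₂ ‖y‖) :
    ∃ W' : ℝ, ∀ m l i j : Fin 3, pd m (christoffel g l i j) y =
      (α₂ * ‖y‖ * α ‖y‖ - α₁ ‖y‖ * (α ‖y‖ + ‖y‖ * α₁ ‖y‖)) / (2 * ‖y‖ ^ 2 * α ‖y‖ ^ 2) / ‖y‖ * y m *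
        (y i * kron j l + y j * kron i l) +
      α₁ ‖y‖ / (2 * ‖y‖ * α ‖y‖) * (kron m i * kron j l + kron m j * kron i l) +
      ((-α₁ ‖y‖ * ‖y‖ - 2 * (1 - α ‖y‖)) / ‖y‖ ^ 3 - (α₂ * ‖y‖ - α₁ ‖y‖) / (2 * ‖y‖ ^ 2)) / ‖y‖ *
        y m * (y l * kron i j) +
      ((1 - α ‖y‖) / ‖y‖ ^ 2 - α₁ ‖y‖ / (2 * ‖y‖)) * (kron m l * kron i j) +
      W' / ‖y‖ * y m * (y l * (y i * y j)) +
      ((-α₁ ‖y‖ * ‖y‖ - 2 * (1 - α ‖y‖)) / (2 * ‖y‖ ^ 4) -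
        α₁ ‖y‖ * (1 - α ‖y‖) / (‖y‖ ^ 3 * α ‖y‖)) *
        (kron m l * (y i * y j) + kron m i * (y l * y j) + kron m j * (y l * y i)) := by
  have hy : y ≠ 0 := hg.self_of_nhds.1
  have hn : ‖y‖ ≠ 0 := by simpa using hy
  obtain ⟨h0, h1⟩ := hα.self_of_nhds
  have hid := hasDerivAt_id ‖y‖
  have hP : HasDerivAt (fun t => α₁ t / (2 * t * α t))
      ((α₂ * ‖y‖ * α ‖y‖ - α₁ ‖y‖ * (α ‖y‖ + ‖y‖ * α₁ ‖y‖)) / (2 * ‖y‖ ^ 2 * α ‖y‖ ^ 2)) ‖y‖ := by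
    refine (hα₁.div ((hid.const_mul 2).mul h1) (by simp [hn, h0])).congr_deriv ?_
    simp only [Pi.mul_apply, id]
    field_simp
  have hQ : HasDerivAt (fun t => (1 - α t) / t ^ 2 - α₁ t / (2 * t))
      ((-α₁ ‖y‖ * ‖y‖ - 2 * (1 - α ‖y‖)) / ‖y‖ ^ 3 - (α₂ * ‖y‖ - α₁ ‖y‖) / (2 * ‖y‖ ^ 2)) ‖y‖ := by
    refine ((((hasDerivAt_const ‖y‖ (1 : ℝ)).sub h1).div (hasDerivAt_pow 2 ‖y‖)
      (by positivity)).sub (hα₁.div (hid.const_mul 2) (by simpa using hn))).congr_deriv ?_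
    simp only [Pi.sub_apply, id]
    field_simp
    push_cast
    ring
  have hW : DifferentiableAt ℝ (fun t => (-α₁ t * t - 2 * (1 - α t)) / (2 * t ^ 4) -
      α₁ t * (1 - α t) / (t ^ 3 * α t)) ‖y‖ := by
    have d0 := h1.differentiableAt
    have d1 := hα₁.differentiableAt
    have n1 : 2 * ‖y‖ ^ 4 ≠ 0 := by positivity
    have n2 : ‖y‖ ^ 3 * α ‖y‖ ≠ 0 := mul_ne_zero (by positivity) h0
    fun_prop (disch := assumption)
  refine ⟨_, fun m l i j => pd_radial_cubic hy hP hQ hW.hasDerivAt ?_ m⟩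
  have hcont : Filter.Tendsto (fun z : E3 => ‖z‖) (𝓝 y) (𝓝 ‖y‖) := continuous_norm.tendsto y
  filter_upwards [eventually_eventually_nhds.2 hg, hcont.eventually hα] with z hz hz'
  exact christoffel_radial hz hz'.1 hz'.2 l i j

/-! ### Curvature, traces and divergence at a point of an axis -/

theorem norm_single_zero {ρ : ℝ} (hρ : 0 < ρ) : ‖(EuclideanSpace.single 0 ρ : E3)‖ = ρ := by
  simp [abs_of_pos hρ]

theorem inv_radial_single {g : Tensor2} {α : ℝ → ℝ} {ρ : ℝ} (hρ : 0 < ρ) (h0 : α ρ ≠ 0)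
    (hg : IsRadialTensorNear g (fun _ => 1) α (EuclideanSpace.single 0 ρ)) (i j : Fin 3) :
    (g (EuclideanSpace.single 0 ρ))⁻¹ i j =
      if i = j then (if i = 0 then 1 else (α ρ)⁻¹) else 0 := by
  have hinv := inv_radial_matrix (A := g (EuclideanSpace.single 0 ρ)) (y := EuclideanSpace.single 0 ρ)
    (a := α ρ) h0 (b := (1 - α ρ) / ρ ^ 2)
    (by rw [norm_single_zero hρ]; field_simp; ring)
    (fun i j => by rw [hg.self_of_nhds.2 i j, norm_single_zero hρ]) i j
  rw [hinv]
  fin_cases i <;> fin_cases j <;> simp [kron]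
  field_simp
  ring

/-- With r² = ρ²α this is r²R[g] = -4rr'' + 2(1 - r'²), rewritten by rr'' = (r²)''/2 - r'² so that
only α and its derivatives occur and no square root is needed. -/
theorem scalarCurvature_radial {g : Tensor2} {α α₁ : ℝ → ℝ} {α₂ ρ : ℝ} (hρ : 0 < ρ)
    (hg : IsRadialTensorNear g (fun _ => 1) α (EuclideanSpace.single 0 ρ))
    (hα : ∀ᶠ t in 𝓝 ρ, α t ≠ 0 ∧ HasDerivAt α (α₁ t) t) (hα₁ : HasDerivAt α₁ α₂ ρ) :
    ρ ^ 2 * α ρ * scalarCurvature g (EuclideanSpace.single 0 ρ) =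
      -4 * (α ρ + 2 * ρ * α₁ ρ + ρ ^ 2 * α₂ / 2) + 2 + 2 * (α ρ + ρ * α₁ ρ / 2) ^ 2 / α ρ := by
  have h0 := hα.self_of_nhds.1
  have hn := norm_single_zero hρ
  rw [← hn] at hα hα₁
  obtain ⟨W', hpd⟩ := pd_christoffel_radial hg hα hα₁
  have hΓ := christoffel_radial hg hα.self_of_nhds.1 hα.self_of_nhds.2
  rw [hn] at hpd hΓ
  have hinv := inv_radial_single hρ h0 hg
  have hx : ∀ i, (EuclideanSpace.single 0 ρ : E3) i = if i = 0 then ρ else 0 := fun i => by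
    fin_cases i <;> simp
  simp only [hx] at hpd hΓ
  have hsc : scalarCurvature g (EuclideanSpace.single 0 ρ) =
      ricci g 0 0 (EuclideanSpace.single 0 ρ) + (α ρ)⁻¹ * (ricci g 1 1 (EuclideanSpace.single 0 ρ) +
        ricci g 2 2 (EuclideanSpace.single 0 ρ)) := by
    rw [scalarCurvature]
    simp [hinv, Fin.sum_univ_three]
    ring
  have r0 : ricci g 0 0 (EuclideanSpace.single 0 ρ) =
      -(2 * α ρ * (ρ * α₂ + 2 * α₁ ρ) - ρ * α₁ ρ ^ 2) / (2 * ρ * α ρ ^ 2) := by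
    rw [ricci]
    simp [hpd, hΓ, Fin.sum_univ_three, kron]
    field_simp
    ring
  have r1 : ricci g 1 1 (EuclideanSpace.single 0 ρ) =
      (1 - α ρ) / ρ ^ 2 - 2 * α₁ ρ / ρ - α₂ / 2 := by
    rw [ricci]
    simp [hpd, hΓ, Fin.sum_univ_three, kron]
    field_simp
    ring
  have r2 : ricci g 2 2 (EuclideanSpace.single 0 ρ) =
      (1 - α ρ) / ρ ^ 2 - 2 * α₁ ρ / ρ - α₂ / 2 := by
    rw [ricci]
    simp [hpd, hΓ, Fin.sum_univ_three, kron]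
    field_simp
    ring
  rw [hsc, r0, r1, r2]
  field_simp
  ring

theorem metricTrace_radial {g k : Tensor2} {α u b : ℝ → ℝ} {y : E3}
    (hg : IsRadialTensorNear g (fun _ => 1) α y) (h0 : α ‖y‖ ≠ 0)
    (hk : IsRadialTensorNear k u b y) :
    metricTrace g k y = u ‖y‖ + 2 * (b ‖y‖ / α ‖y‖) := by
  have hn : ‖y‖ ≠ 0 := by simpa using hg.self_of_nhds.1
  have hinv := inv_radial_matrix (A := g y) (y := y) h0 (b := (1 - α ‖y‖) / ‖y‖ ^ 2)
    (by field_simp; ring) (hg.self_of_nhds.2)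
  have e : ∀ i, ∑ j, (g y)⁻¹ i j * k y i j = (α ‖y‖)⁻¹ * b ‖y‖ +
      ((α ‖y‖)⁻¹ * ((u ‖y‖ - b ‖y‖) / ‖y‖ ^ 2) - (1 - α ‖y‖) / ‖y‖ ^ 2 / α ‖y‖ * u ‖y‖) *
        (y i * y i) := fun i => by
    have e' : ∀ j, (g y)⁻¹ i j * k y i j = kron i j * ((α ‖y‖)⁻¹ * b ‖y‖ * kron i j +
        ((α ‖y‖)⁻¹ * ((u ‖y‖ - b ‖y‖) / ‖y‖ ^ 2) -
          (1 - α ‖y‖) / ‖y‖ ^ 2 / α ‖y‖ * b ‖y‖) * (y i * y j)) -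
        (1 - α ‖y‖) / ‖y‖ ^ 2 / α ‖y‖ * ((u ‖y‖ - b ‖y‖) / ‖y‖ ^ 2) * (y i * y i) * (y j * y j) :=
      fun j => by
        rw [hinv, hk.self_of_nhds.2]
        ring
    rw [Finset.sum_congr rfl fun j _ => e' j, Finset.sum_sub_distrib, sum_kron_mul,
      ← Finset.mul_sum, norm_sq_eq_sum_mul]
    simp only [kron, if_true]
    field_simp
    ring
  rw [metricTrace, Finset.sum_congr rfl fun i _ => e i, Finset.sum_add_distrib, Finset.sum_const,
    ← Finset.mul_sum, norm_sq_eq_sum_mul]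
  simp
  field_simp
  ring

theorem metricTrace_single {g k : Tensor2} {α u b : ℝ → ℝ} {ρ : ℝ} (hρ : 0 < ρ) (h0 : α ρ ≠ 0)
    (hg : IsRadialTensorNear g (fun _ => 1) α (EuclideanSpace.single 0 ρ))
    (hk : IsRadialTensorNear k u b (EuclideanSpace.single 0 ρ)) :
    metricTrace g k (EuclideanSpace.single 0 ρ) = u ρ + 2 * (b ρ / α ρ) := by
  rw [metricTrace_radial hg (by rwa [norm_single_zero hρ]) hk, norm_single_zero hρ]

theorem radial_tensor_single {k : Tensor2} {u b : ℝ → ℝ} {ρ : ℝ} (hρ : 0 < ρ)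
    (hk : IsRadialTensorNear k u b (EuclideanSpace.single 0 ρ)) (i j : Fin 3) :
    k (EuclideanSpace.single 0 ρ) i j = if i = j then (if i = 0 then u ρ else b ρ) else 0 := by
  rw [hk.self_of_nhds.2, norm_single_zero hρ]
  fin_cases i <;> fin_cases j <;> simp [kron]
  field_simp
  ring

theorem tensorNormSq_single {g k : Tensor2} {α u b : ℝ → ℝ} {ρ : ℝ} (hρ : 0 < ρ) (h0 : α ρ ≠ 0)
    (hg : IsRadialTensorNear g (fun _ => 1) α (EuclideanSpace.single 0 ρ))
    (hk : IsRadialTensorNear k u b (EuclideanSpace.single 0 ρ)) :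
    tensorNormSq g k (EuclideanSpace.single 0 ρ) = u ρ ^ 2 + 2 * (b ρ / α ρ) ^ 2 := by
  simp [tensorNormSq, inv_radial_single hρ h0 hg, radial_tensor_single hρ hk, Fin.sum_univ_three]
  field_simp
  ring

theorem gradNormSq_single {g : Tensor2} {α : ℝ → ℝ} {ψ : E3 → ℝ} {φ' ρ : ℝ} (hρ : 0 < ρ)
    (h0 : α ρ ≠ 0) (hg : IsRadialTensorNear g (fun _ => 1) α (EuclideanSpace.single 0 ρ))
    (hψ : ∀ m, pd m ψ (EuclideanSpace.single 0 ρ) = if m = 0 then φ' else 0) :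
    gradNormSq g ψ (EuclideanSpace.single 0 ρ) = φ' ^ 2 := by
  simp [gradNormSq, inv_radial_single hρ h0 hg, hψ]
  ring

theorem pd_metricTrace_radial {g k : Tensor2} {α u b : ℝ → ℝ} {α' u' b' ρ : ℝ} (hρ : 0 < ρ)
    (hg : IsRadialTensorNear g (fun _ => 1) α (EuclideanSpace.single 0 ρ))
    (hk : IsRadialTensorNear k u b (EuclideanSpace.single 0 ρ))
    (h0 : ∀ᶠ t in 𝓝 ρ, α t ≠ 0) (hα : HasDerivAt α α' ρ) (hu : HasDerivAt u u' ρ)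
    (hb : HasDerivAt b b' ρ) :
    pd 0 (metricTrace g k) (EuclideanSpace.single 0 ρ) =
      u' + 2 * ((b' * α ρ - b ρ * α') / α ρ ^ 2) := by
  have hn := norm_single_zero hρ
  have hd := hu.add ((hb.div hα h0.self_of_nhds).const_mul 2)
  rw [← hn] at hd
  rw [pd_radial hg.self_of_nhds.1 hd]
  · rw [hn]; simp [hρ.ne']
  · have hcont : Filter.Tendsto (fun z : E3 => ‖z‖) (𝓝 (EuclideanSpace.single 0 ρ)) (𝓝 ρ) := by
      have := continuous_norm.tendsto (EuclideanSpace.single 0 ρ : E3)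
      rwa [hn] at this
    filter_upwards [eventually_eventually_nhds.2 hg, eventually_eventually_nhds.2 hk,
      hcont.eventually h0] with z hz hz' hz0
    exact metricTrace_radial hz hz0 hz'

theorem divergence_radial {g k : Tensor2} {α u b : ℝ → ℝ} {α' u' b' ρ : ℝ} (hρ : 0 < ρ)
    (hg : IsRadialTensorNear g (fun _ => 1) α (EuclideanSpace.single 0 ρ))
    (hk : IsRadialTensorNear k u b (EuclideanSpace.single 0 ρ))
    (h0 : α ρ ≠ 0) (hα : HasDerivAt α α' ρ) (hu : HasDerivAt u u' ρ) (hb : HasDerivAt b b' ρ) :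
    divergence g k 0 (EuclideanSpace.single 0 ρ) =
      u' + 2 * (1 / ρ + α' / (2 * α ρ)) * (u ρ - b ρ / α ρ) := by
  have hn := norm_single_zero hρ
  have hβ : HasDerivAt (fun t => (u t - b t) / t ^ 2)
      (((u' - b') * ρ - 2 * (u ρ - b ρ)) / ρ ^ 3) ρ := by
    refine ((hu.sub hb).div (hasDerivAt_pow 2 ρ) (by positivity)).congr_deriv ?_
    simp only [Pi.sub_apply]
    field_simp
    push_cast
    ring
  have hΓ := christoffel_radial (α' := α') hg (by rwa [hn]) (by rwa [hn])
  rw [← hn] at hb hβ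
  have hpd (m i j : Fin 3) : pd m (fun z => k z i j) (EuclideanSpace.single 0 ρ) = _ :=
    pd_radial_quadratic hg.self_of_nhds.1 hb hβ (c := kron i j) (i := i) (j := j)
      (hk.mono fun z hz => hz.2 i j) m
  rw [hn] at hΓ hpd
  have hx : ∀ i, (EuclideanSpace.single 0 ρ : E3) i = if i = 0 then ρ else 0 := fun i => by
    fin_cases i <;> simp
  simp only [hx] at hpd hΓ
  have c0 : covDerivTensor g k 0 0 0 (EuclideanSpace.single 0 ρ) = u' := by
    rw [covDerivTensor]
    simp [hpd, hΓ, radial_tensor_single hρ hk, Fin.sum_univ_three, kron]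
    field_simp
    ring
  have c1 : covDerivTensor g k 1 1 0 (EuclideanSpace.single 0 ρ) =
      (1 / ρ + α' / (2 * α ρ)) * (u ρ * α ρ - b ρ) := by
    rw [covDerivTensor]
    simp [hpd, hΓ, radial_tensor_single hρ hk, Fin.sum_univ_three, kron]
    field_simp
    ring
  have c2 : covDerivTensor g k 2 2 0 (EuclideanSpace.single 0 ρ) =
      (1 / ρ + α' / (2 * α ρ)) * (u ρ * α ρ - b ρ) := by
    rw [covDerivTensor]
    simp [hpd, hΓ, radial_tensor_single hρ hk, Fin.sum_univ_three, kron]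
    field_simp
    ring
  rw [divergence]
  simp [inv_radial_single hρ h0 hg, Fin.sum_univ_three, c0, c1, c2]
  field_simp
  ring

/-! ### The radial constraint equations and the continuity argument -/

theorem abs_le_of_abs_deriv_le {f f' g g' : ℝ → ℝ} {ρ : ℝ} (hρ : 0 ≤ ρ)
    (hf : ContinuousOn f (Set.Icc 0 ρ)) (hg : ContinuousOn g (Set.Icc 0 ρ)) (hf0 : f 0 = 0)
    (hg0 : g 0 = 0) (hf' : ∀ t ∈ Set.Ioo 0 ρ, HasDerivAt f (f' t) t)
    (hg' : ∀ t ∈ Set.Ioo 0 ρ, HasDerivAt g (g' t) t) (h : ∀ t ∈ Set.Ioo 0 ρ, |f' t| ≤ g' t) :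
    |f ρ| ≤ g ρ := by
  have hmono {w w' : ℝ → ℝ} (hw : ContinuousOn w (Set.Icc 0 ρ))
      (hw' : ∀ t ∈ Set.Ioo 0 ρ, HasDerivAt w (w' t) t) (hnn : ∀ t ∈ Set.Ioo 0 ρ, 0 ≤ w' t) :
      w 0 ≤ w ρ := by
    refine monotoneOn_of_deriv_nonneg (convex_Icc 0 ρ) hw ?_ ?_ (Set.left_mem_Icc.2 hρ)
      (Set.right_mem_Icc.2 hρ) hρ
    · rw [interior_Icc]
      exact fun t ht => (hw' t ht).differentiableAt.differentiableWithinAt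
    · rw [interior_Icc]
      intro t ht
      rw [(hw' t ht).deriv]
      exact hnn t ht
  have h1 := hmono (hg.sub hf) (fun t ht => (hg' t ht).sub (hf' t ht)) fun t ht => by
    linarith [le_abs_self (f' t), h t ht]
  have h2 := hmono (hg.add hf) (fun t ht => (hg' t ht).add (hf' t ht)) fun t ht => by
    linarith [neg_abs_le (f' t), h t ht]
  simp only [Pi.sub_apply, Pi.add_apply, hf0, hg0] at h1 h2
  exact abs_le.2 ⟨by linarith, by linarith⟩

/-- The constraint equations in spherical symmetry, for the area radius `r` with derivatives
`r₁` and `r₂`, the rescaled tangential component `κ = k_ϑϑ / r`, the radial component `u = k_ρρ`,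
the Cartesian component `b = k_ϑϑ / ρ²`, and the scalar field data `φ₁ = ∂_ρ ψ₀` and `ψ = ψ₁`. The
function `G` is the primitive of the energy density. -/
structure RadialConstraints (R δ : ℝ) (r r₁ r₂ κ u b φ₁ ψ G : ℝ → ℝ) : Prop where
  hasDerivAt_r : ∀ t ∈ Set.Ico 0 R, HasDerivAt r (r₁ t) t
  hasDerivAt_r₁ : ∀ t ∈ Set.Ico 0 R, HasDerivAt r₁ (r₂ t) t
  r_zero : r 0 = 0
  r₁_zero : r₁ 0 = 1
  continuousOn_κ : ContinuousOn κ (Set.Ico 0 R)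
  κ_zero : κ 0 = 0
  momentum : ∀ t ∈ Set.Ioo 0 R, HasDerivAt κ (r₁ t * u t - r t * (ψ t * φ₁ t) / 2) t
  hamiltonian : ∀ t ∈ Set.Ioo 0 R, -4 * (r t * r₂ t) + 2 * (1 - r₁ t ^ 2) + 4 * (u t * κ t * r t) +
    2 * κ t ^ 2 = r t ^ 2 * (φ₁ t ^ 2 + ψ t ^ 2)
  r_mul_κ : ∀ t ∈ Set.Ioo 0 R, r t * κ t = t ^ 2 * b t
  continuousOn_G : ContinuousOn G (Set.Ico 0 R)
  G_zero : G 0 = 0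
  hasDerivAt_G : ∀ t ∈ Set.Ioo 0 R,
    HasDerivAt G (t ^ 2 * (u t ^ 2 + 2 * b t ^ 2 + φ₁ t ^ 2 + ψ t ^ 2)) t
  G_le : ∀ t ∈ Set.Ioo 0 R, G t ≤ δ * t

namespace RadialConstraints

variable {R δ : ℝ} {r r₁ r₂ κ u b φ₁ ψ G : ℝ → ℝ}

theorem continuousOn_r (h : RadialConstraints R δ r r₁ r₂ κ u b φ₁ ψ G) :
    ContinuousOn r (Set.Ico 0 R) := fun t ht => (h.hasDerivAt_r t ht).continuousAt.continuousWithinAt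

theorem continuousOn_r₁ (h : RadialConstraints R δ r r₁ r₂ κ u b φ₁ ψ G) :
    ContinuousOn r₁ (Set.Ico 0 R) :=
  fun t ht => (h.hasDerivAt_r₁ t ht).continuousAt.continuousWithinAt

theorem abs_r_sub_le (h : RadialConstraints R δ r r₁ r₂ κ u b φ₁ ψ G) {ρ : ℝ}
    (hρ : ρ ∈ Set.Ioo 0 R) (hr : ∀ t ∈ Set.Icc 0 ρ, |r₁ t - 1| ≤ 1 / 2) : |r ρ - ρ| ≤ ρ / 2 := by
  have hsub : Set.Icc 0 ρ ⊆ Set.Ico 0 R := fun t ht => ⟨ht.1, ht.2.trans_lt hρ.2⟩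
  refine abs_le_of_abs_deriv_le (f := fun t => r t - t) (g := fun t => t / 2)
    (f' := fun t => r₁ t - 1) (g' := fun _ => 1 / 2) hρ.1.le
    ((h.continuousOn_r.mono hsub).sub continuousOn_id) (by fun_prop) (by simp [h.r_zero]) (by simp)
    (fun t ht => (h.hasDerivAt_r t (hsub (Set.Ioo_subset_Icc_self ht))).sub (hasDerivAt_id t))
    (fun t ht => (hasDerivAt_id t).div_const 2) fun t ht => hr t (Set.Ioo_subset_Icc_self ht)

/-- Bounding κ by integrating |u| directly would lose a logarithm, since only the integral of t²u²
is known to be at most δρ. The function tκ avoids this: its derivative contains κ, which is at most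
2|tb|, and tr'u, and both integrate to a small multiple of ρ. -/
theorem abs_κ_le (h : RadialConstraints R (1 / 1000) r r₁ r₂ κ u b φ₁ ψ G) {ρ : ℝ}
    (hρ : ρ ∈ Set.Ioo 0 R) (hr : ∀ t ∈ Set.Icc 0 ρ, |r₁ t - 1| ≤ 1 / 2) : |κ ρ| ≤ 1 / 4 := by
  have hsub : Set.Icc 0 ρ ⊆ Set.Ico 0 R := fun t ht => ⟨ht.1, ht.2.trans_lt hρ.2⟩
  have hsub' : Set.Ioo 0 ρ ⊆ Set.Ioo 0 R := fun t ht => ⟨ht.1, ht.2.trans hρ.2⟩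
  -- Young's inequality replaces Cauchy–Schwarz, so a pointwise comparison of derivatives suffices.
  -- The constant 7/64 is (1 + 3/4)/16, and 21 generously covers the quadratic terms. With G ≤
  -- ρ/1000 the sum stays below ρ/4.
  have key : |ρ * κ ρ| ≤ 7 / 64 * ρ + 21 * G ρ := by
    refine abs_le_of_abs_deriv_le (f := fun t => t * κ t) (g := fun t => 7 / 64 * t + 21 * G t)
      (f' := fun t => 1 * κ t + t * (r₁ t * u t - r t * (ψ t * φ₁ t) / 2))
      (g' := fun t => 7 / 64 * 1 +
        21 * (t ^ 2 * (u t ^ 2 + 2 * b t ^ 2 + φ₁ t ^ 2 + ψ t ^ 2))) hρ.1.le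
      (continuousOn_id.mul (h.continuousOn_κ.mono hsub))
      ((continuousOn_const.mul continuousOn_id).add
        (continuousOn_const.mul (h.continuousOn_G.mono hsub))) (by simp) (by simp [h.G_zero])
      (fun t ht => (hasDerivAt_id t).mul (h.momentum t (hsub' ht)))
      (fun t ht => ((hasDerivAt_id t).const_mul _).add ((h.hasDerivAt_G t (hsub' ht)).const_mul _))
      fun t ht => ?_
    have ht0 : 0 < t := ht.1
    have h1 := abs_le.1 (hr t (Set.Ioo_subset_Icc_self ht))
    have h2 := abs_le.1 (h.abs_r_sub_le (hsub' ht) fun s hs => hr s ⟨hs.1, hs.2.trans ht.2.le⟩)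
    have hrb : t / 2 ≤ r t ∧ r t ≤ 3 / 2 * t := ⟨by linarith, by linarith⟩
    have hκ : |κ t| ≤ 2 * |t * b t| := by
      have e := congrArg abs (h.r_mul_κ t (hsub' ht))
      rw [show t ^ 2 * b t = t * (t * b t) by ring, abs_mul, abs_mul t, abs_of_pos ht0,
        abs_of_pos (by linarith : 0 < r t)] at e
      have : t / 2 * |κ t| ≤ t * |t * b t| := by
        rw [← e]; gcongr; exact hrb.1
      nlinarith
    have hu : |t * (r₁ t * u t)| ≤ 3 / 2 * |t * u t| := by
      rw [show t * (r₁ t * u t) = r₁ t * (t * u t) by ring, abs_mul]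
      gcongr
      exact abs_le.2 ⟨by linarith, by linarith⟩
    have hψ : |t * (r t * (ψ t * φ₁ t) / 2)| ≤ 3 / 8 * (t ^ 2 * (φ₁ t ^ 2 + ψ t ^ 2)) := by
      have e1 : |ψ t * φ₁ t| ≤ (φ₁ t ^ 2 + ψ t ^ 2) / 2 :=
        abs_le.2 ⟨by nlinarith [sq_nonneg (φ₁ t + ψ t)], by nlinarith [sq_nonneg (φ₁ t - ψ t)]⟩
      rw [show t * (r t * (ψ t * φ₁ t) / 2) = (t * r t / 2) * (ψ t * φ₁ t) by ring, abs_mul,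
        abs_of_pos (by nlinarith : 0 < t * r t / 2)]
      calc t * r t / 2 * |ψ t * φ₁ t| ≤ t * (3 / 2 * t) / 2 * ((φ₁ t ^ 2 + ψ t ^ 2) / 2) := by
            gcongr
            exact hrb.2
        _ = _ := by ring
    have q1 : 2 * |t * b t| ≤ 1 / 16 + 16 * (t ^ 2 * b t ^ 2) := by
      have := sq_nonneg (|t * b t| - 1 / 16)
      have e := sq_abs (t * b t)
      nlinarith
    have q2 : 3 / 2 * |t * u t| ≤ 3 / 4 * (1 / 16 + 16 * (t ^ 2 * u t ^ 2)) := by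
      have := sq_nonneg (|t * u t| - 1 / 16)
      have e := sq_abs (t * u t)
      nlinarith
    have p1 : 0 ≤ t ^ 2 * b t ^ 2 := by positivity
    have p2 : 0 ≤ t ^ 2 * u t ^ 2 := by positivity
    have p3 : 0 ≤ t ^ 2 * (φ₁ t ^ 2 + ψ t ^ 2) := by positivity
    calc |1 * κ t + t * (r₁ t * u t - r t * (ψ t * φ₁ t) / 2)|
        ≤ |κ t| + |t * (r₁ t * u t)| + |t * (r t * (ψ t * φ₁ t) / 2)| := by
          rw [show 1 * κ t + t * (r₁ t * u t - r t * (ψ t * φ₁ t) / 2) =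
            κ t + t * (r₁ t * u t) - t * (r t * (ψ t * φ₁ t) / 2) by ring]
          exact (abs_sub _ _).trans (by gcongr; exact abs_add_le _ _)
      _ ≤ _ := by nlinarith
  rw [abs_mul, abs_of_pos hρ.1] at key
  have := h.G_le ρ hρ
  have : ρ * |κ ρ| ≤ ρ * (1 / 4) := by linarith [hρ.1]
  exact le_of_mul_le_mul_left this hρ.1

/-- The mass r(1 - r'² + κ²) starts at 0 and has a derivative controlled by that of G. Dividing by r
≥ ρ/2 makes 1 - r'² + κ² small; as κ² ≤ 1/16, r'² is close to 1, and the assumed r' ≥ 1/2 excludes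
the negative root. -/
theorem abs_r₁_sub_le (h : RadialConstraints R (1 / 1000) r r₁ r₂ κ u b φ₁ ψ G) {ρ : ℝ}
    (hρ : ρ ∈ Set.Ioo 0 R) (hr : ∀ t ∈ Set.Icc 0 ρ, |r₁ t - 1| ≤ 1 / 2) : |r₁ ρ - 1| ≤ 1 / 4 := by
  have hsub : Set.Icc 0 ρ ⊆ Set.Ico 0 R := fun t ht => ⟨ht.1, ht.2.trans_lt hρ.2⟩
  have hsub' : Set.Ioo 0 ρ ⊆ Set.Ioo 0 R := fun t ht => ⟨ht.1, ht.2.trans hρ.2⟩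
  have cr := h.continuousOn_r.mono hsub
  have cr₁ := h.continuousOn_r₁.mono hsub
  have cκ := h.continuousOn_κ.mono hsub
  have key : |r ρ * (1 - r₁ ρ ^ 2 + κ ρ ^ 2)| ≤ 3 * G ρ := by
    refine abs_le_of_abs_deriv_le (f := fun t => r t * (1 - r₁ t ^ 2 + κ t ^ 2))
      (g := fun t => 3 * G t)
      (f' := fun t => r t ^ 2 * (r₁ t * (φ₁ t ^ 2 + ψ t ^ 2) / 2 - κ t * (ψ t * φ₁ t)))
      (g' := fun t => 3 * (t ^ 2 * (u t ^ 2 + 2 * b t ^ 2 + φ₁ t ^ 2 + ψ t ^ 2))) hρ.1.le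
      (cr.mul ((continuousOn_const.sub (cr₁.pow 2)).add (cκ.pow 2)))
      (continuousOn_const.mul (h.continuousOn_G.mono hsub)) (by simp [h.r_zero]) (by simp [h.G_zero])
      (fun t ht => ?_) (fun t ht => (h.hasDerivAt_G t (hsub' ht)).const_mul _) fun t ht => ?_
    · have ht' := hsub (Set.Ioo_subset_Icc_self ht)
      refine ((h.hasDerivAt_r t ht').mul ((((h.hasDerivAt_r₁ t ht').pow 2).const_sub 1).add
        ((h.momentum t (hsub' ht)).pow 2))).congr_deriv ?_
      have := h.hamiltonian t (hsub' ht)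
      simp only [Pi.add_apply, Pi.pow_apply]
      push_cast
      -- The terms with u from (κ²)' and from the Hamiltonian constraint cancel here.
      linear_combination r₁ t / 2 * this
    · have ht0 : 0 < t := ht.1
      have hr' : ∀ s ∈ Set.Icc 0 t, |r₁ s - 1| ≤ 1 / 2 := fun s hs => hr s ⟨hs.1, hs.2.trans ht.2.le⟩
      have h1 := abs_le.1 (hr t (Set.Ioo_subset_Icc_self ht))
      have h2 := abs_le.1 (h.abs_r_sub_le (hsub' ht) hr')
      have h3 := h.abs_κ_le (hsub' ht) hr'
      have hE : 0 ≤ φ₁ t ^ 2 + ψ t ^ 2 := by positivity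
      have e1 : |ψ t * φ₁ t| ≤ (φ₁ t ^ 2 + ψ t ^ 2) / 2 :=
        abs_le.2 ⟨by nlinarith [sq_nonneg (φ₁ t + ψ t)], by nlinarith [sq_nonneg (φ₁ t - ψ t)]⟩
      have e2 : |κ t * (ψ t * φ₁ t)| ≤ 1 / 4 * ((φ₁ t ^ 2 + ψ t ^ 2) / 2) := by
        rw [abs_mul]; gcongr
      have e3 : |r₁ t * (φ₁ t ^ 2 + ψ t ^ 2) / 2| ≤ 3 / 4 * (φ₁ t ^ 2 + ψ t ^ 2) :=
        abs_le.2 ⟨by nlinarith, by nlinarith⟩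
      have hr0 : 0 < r t := by linarith
      have hr2 : r t ^ 2 ≤ (3 / 2 * t) ^ 2 := by
        gcongr
        linarith
      have p1 : 0 ≤ t ^ 2 * (u t ^ 2 + 2 * b t ^ 2) := by positivity
      have p3 : 0 ≤ t ^ 2 * (φ₁ t ^ 2 + ψ t ^ 2) := by positivity
      rw [abs_mul, abs_of_pos (by positivity : 0 < r t ^ 2)]
      calc r t ^ 2 * |r₁ t * (φ₁ t ^ 2 + ψ t ^ 2) / 2 - κ t * (ψ t * φ₁ t)|
          ≤ (3 / 2 * t) ^ 2 * (3 / 4 * (φ₁ t ^ 2 + ψ t ^ 2) +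
            1 / 4 * ((φ₁ t ^ 2 + ψ t ^ 2) / 2)) := by
            gcongr
            exact (abs_sub _ _).trans (by gcongr)
        _ ≤ _ := by nlinarith
  have h1 := abs_le.1 (hr ρ (Set.right_mem_Icc.2 hρ.1.le))
  have h2 := abs_le.1 (h.abs_r_sub_le hρ hr)
  have h3 := abs_le.1 (h.abs_κ_le hρ hr)
  have hG := h.G_le ρ hρ
  have hρ0 : 0 < ρ := hρ.1
  rw [abs_mul, abs_of_pos (by linarith : 0 < r ρ)] at key
  have h4 : ρ / 2 * |1 - r₁ ρ ^ 2 + κ ρ ^ 2| ≤ ρ / 2 * (6 / 1000) := by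
    calc ρ / 2 * |1 - r₁ ρ ^ 2 + κ ρ ^ 2| ≤ r ρ * |1 - r₁ ρ ^ 2 + κ ρ ^ 2| := by
          gcongr
          linarith
      _ ≤ _ := by linarith
  have h5 := abs_le.1 (le_of_mul_le_mul_left h4 (by positivity))
  have h6 : κ ρ ^ 2 ≤ 1 / 16 := by nlinarith
  have h7 := sq_nonneg (κ ρ)
  exact abs_le.2 ⟨by nlinarith, by nlinarith⟩

theorem abs_r₁_sub_le_half (h : RadialConstraints R (1 / 1000) r r₁ r₂ κ u b φ₁ ψ G) {ρ : ℝ}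
    (hρ : ρ ∈ Set.Ioo 0 R) : ∀ t ∈ Set.Icc 0 ρ, |r₁ t - 1| ≤ 1 / 2 := by
  have hc : ContinuousOn (fun t => |r₁ t - 1|) (Set.Icc 0 ρ) :=
    ((h.continuousOn_r₁.mono fun t ht => ⟨ht.1, ht.2.trans_lt hρ.2⟩).sub continuousOn_const).abs
  by_contra! hcon
  obtain ⟨t₀, ht₀, ht₀'⟩ := hcon
  have hA : IsCompact (Set.Icc 0 ρ ∩ (fun t => |r₁ t - 1|) ⁻¹' Set.Ici (1 / 2)) :=
    isCompact_Icc.of_isClosed_subset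
      (hc.preimage_isClosed_of_isClosed isClosed_Icc isClosed_Ici) Set.inter_subset_left
  -- At the first time τ where the deviation reaches 1/2, the intermediate value theorem makes it
  -- exactly 1/2. The assumption thus holds on all of [0, τ], and the improved bound 1/4 at τ is a
  -- contradiction.
  obtain ⟨τ, ⟨hτ, hτ'⟩, hmin⟩ := hA.exists_isLeast ⟨t₀, ht₀, ht₀'.le⟩
  have hτ' : 1 / 2 ≤ |r₁ τ - 1| := hτ'
  have hlt : ∀ t ∈ Set.Icc 0 τ, t < τ → |r₁ t - 1| < 1 / 2 := fun t ht htτ => by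
    by_contra! hge
    exact htτ.not_ge (hmin ⟨⟨ht.1, ht.2.trans hτ.2⟩, hge⟩)
  have hτ0 : 0 < τ := hτ.1.lt_of_ne fun h0 => by
    rw [← h0, h.r₁_zero] at hτ'
    norm_num at hτ'
  obtain ⟨s, hs, hs'⟩ := intermediate_value_Icc hτ.1
    (hc.mono (Set.Icc_subset_Icc_right hτ.2)) (show (1 / 2 : ℝ) ∈ Set.Icc _ _ from
      ⟨by simp [h.r₁_zero], hτ'⟩)
  have hsτ : s = τ := by
    by_contra hne
    exact (hlt s hs (hs.2.lt_of_ne hne)).ne hs'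
  have hle : ∀ t ∈ Set.Icc 0 τ, |r₁ t - 1| ≤ 1 / 2 := fun t ht => by
    rcases ht.2.lt_or_eq with h1 | h1
    · exact (hlt t ht h1).le
    · rw [h1, ← hsτ]; exact hs'.le
  have := h.abs_r₁_sub_le ⟨hτ0, hτ.2.trans_lt hρ.2⟩ hle
  linarith

theorem abs_κ_lt (h : RadialConstraints R (1 / 1000) r r₁ r₂ κ u b φ₁ ψ G) {ρ : ℝ}
    (hρ : ρ ∈ Set.Ioo 0 R) : |κ ρ| < |r₁ ρ| := by
  have h1 := h.abs_κ_le hρ (h.abs_r₁_sub_le_half hρ)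
  have h2 := abs_le.1 (h.abs_r₁_sub_le hρ (h.abs_r₁_sub_le_half hρ))
  have := le_abs_self (r₁ ρ)
  linarith

end RadialConstraints

/-! ### Invariant surfaces and the trapping condition on a sphere -/

/-- For points of equal norm, the reflection in the hyperplane orthogonal to p - q exchanges p and
q. -/
theorem SphericalData.IsSphericallySymmetricSet.mem_of_norm_eq {S : Set E3} (hS : IsSphericallySymmetricSet S)
    {p q : E3} (hp : p ∈ S) (h : ‖p‖ = ‖q‖) : q ∈ S := by
  rw [← hS (Submodule.reflection (ℝ ∙ (p - q))ᗮ)]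
  exact ⟨p, hp, Submodule.reflection_sub h⟩

/-- Rules out a surface consisting of the origin alone. `F` has opposite signs at tv and -tv for
small t > 0, and the sphere through these two points is connected, so `F` vanishes somewhere on it.
-/
theorem exists_zero_on_sphere {F : E3 → ℝ} {U : Set E3} (hU : IsOpen U) (h0 : (0 : E3) ∈ U)
    (hF : ContDiffOn ℝ ∞ F U) (hF0 : F 0 = 0) (hd : fderiv ℝ F 0 ≠ 0) :
    ∃ z ∈ U, z ≠ 0 ∧ F z = 0 := by
  obtain ⟨v, hv⟩ : ∃ v, 0 < fderiv ℝ F 0 v := by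
    obtain ⟨v, hv⟩ := DFunLike.ne_iff.1 hd
    rcases lt_or_gt_of_ne hv with h | h
    · exact ⟨-v, by simpa using h⟩
    · exact ⟨v, by simpa using h⟩
  have hFd : HasFDerivAt F (fderiv ℝ F 0) 0 :=
    ((hF.contDiffAt (hU.mem_nhds h0)).differentiableAt (by simp)).hasFDerivAt
  have hslope : ∀ᶠ t in 𝓝[≠] (0 : ℝ), 0 < t⁻¹ * F (t • v) := by
    have h1 : HasDerivAt (fun t : ℝ => F (t • v)) (fderiv ℝ F 0 v) 0 := by
      have := (hasDerivAt_id (0 : ℝ)).smul_const v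
      have h2 : HasFDerivAt F (fderiv ℝ F 0) ((0 : ℝ) • v) := by rwa [zero_smul]
      exact (h2.comp_hasDerivAt (0 : ℝ) this).congr_deriv (by simp)
    have := (hasDerivAt_iff_tendsto_slope_zero.1 h1).eventually_const_lt hv
    simpa [hF0] using this
  obtain ⟨ε, hε, hεU⟩ := Metric.isOpen_iff.1 hU 0 h0
  have hv0 : v ≠ 0 := fun h => by simp [h] at hv
  obtain ⟨δ, hδ, hδs⟩ := Metric.eventually_nhds_iff.1 (eventually_nhdsWithin_iff.1 hslope)
  obtain ⟨t, ht0, ht⟩ : ∃ t : ℝ, 0 < t ∧ t < δ ∧ t * ‖v‖ < ε := by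
    have hvn : 0 < ‖v‖ := norm_pos_iff.2 hv0
    refine ⟨min (δ / 2) (ε / (2 * ‖v‖)), by positivity, ?_, ?_⟩
    · exact (min_le_left _ _).trans_lt (by linarith)
    · calc _ ≤ ε / (2 * ‖v‖) * ‖v‖ := by gcongr; exact min_le_right _ _
        _ = ε / 2 := by field_simp
        _ < ε := by linarith
  have hpos : 0 < F (t • v) := by
    have := hδs (y := t) (by simpa [abs_of_pos ht0] using ht.1) (by simpa using ht0.ne')
    exact pos_of_mul_pos_right this (by positivity)
  have hneg : F ((-t) • v) < 0 := by
    have := hδs (y := -t) (by simpa [abs_of_pos ht0] using ht.1) (by simpa using ht0.ne')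
    have h2 : (-t)⁻¹ < 0 := by simpa using ht0
    exact neg_of_mul_pos_right this h2.le
  have hsub : sphere (0 : E3) (t * ‖v‖) ⊆ U := fun z hz => hεU (by
    rw [mem_sphere_zero_iff_norm] at hz
    simpa [hz] using ht.2)
  have hconn : IsPreconnected (sphere (0 : E3) (t * ‖v‖)) := by
    apply isPreconnected_sphere
    rw [rank_eq_card_basis (EuclideanSpace.basisFun (Fin 3) ℝ).toBasis]
    simp
  obtain ⟨z, hz, hz0⟩ := hconn.intermediate_value (a := (-t) • v) (b := t • v)
    (by simp [norm_smul, abs_of_pos ht0]) (by simp [norm_smul, abs_of_pos ht0])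
    (hF.continuousOn.mono hsub) (show (0 : ℝ) ∈ Set.Icc _ _ from ⟨hneg.le, hpos.le⟩)
  refine ⟨z, hsub hz, fun h => ?_, hz0⟩
  rw [mem_sphere_zero_iff_norm, h, norm_zero] at hz
  have : 0 < t * ‖v‖ := mul_pos ht0 (norm_pos_iff.2 hv0)
  linarith

theorem exists_single_mem {S : Set E3} (hS : IsCompactEmbeddedSurface S)
    (hsym : IsSphericallySymmetricSet S) : ∃ ρ : ℝ, 0 < ρ ∧ EuclideanSpace.single 0 ρ ∈ S := by
  obtain ⟨p, hp, hp0⟩ : ∃ p ∈ S, p ≠ 0 := by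
    obtain ⟨p, hp⟩ := hS.nonempty
    rcases eq_or_ne p 0 with rfl | hp0
    · obtain ⟨U, hU, h0, F, hF, hd, hSU⟩ := hS.locallyRegular 0 hp
      have hF0 : F 0 = 0 := (hSU.subset ⟨hp, h0⟩).2
      obtain ⟨z, hz, hz0, hFz⟩ := exists_zero_on_sphere hU h0 hF hF0 (hd 0 h0)
      exact ⟨z, (hSU.superset ⟨hz, hFz⟩).1, hz0⟩
    · exact ⟨p, hp, hp0⟩
  have hpos : 0 < ‖p‖ := norm_pos_iff.2 hp0
  exact ⟨‖p‖, hpos, hsym.mem_of_norm_eq hp (norm_single_zero hpos).symm⟩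

theorem exists_curve_on_sphere {q v : E3} (hq : q ≠ 0) (hv : inner ℝ q v = 0) :
    ∃ γ : ℝ → E3, γ 0 = q ∧ HasDerivAt γ v 0 ∧ ∀ t, ‖γ t‖ = ‖q‖ := by
  have hq' : 0 < ‖q‖ := norm_pos_iff.2 hq
  have hpos (t : ℝ) : 0 < ‖q‖ ^ 2 + t ^ 2 * ‖v‖ ^ 2 := by positivity
  refine ⟨fun t => (‖q‖ / √(‖q‖ ^ 2 + t ^ 2 * ‖v‖ ^ 2)) • (q + t • v), ?_, ?_, fun t => ?_⟩
  · simp [hq]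
  · have h1 : HasDerivAt (fun t : ℝ => ‖q‖ / √(‖q‖ ^ 2 + t ^ 2 * ‖v‖ ^ 2)) 0 0 := by
      have h2 := (((hasDerivAt_pow 2 (0 : ℝ)).mul_const (‖v‖ ^ 2)).const_add (‖q‖ ^ 2)).sqrt
        (hpos 0).ne'
      have h3 := (hasDerivAt_const (0 : ℝ) ‖q‖).div h2 (Real.sqrt_ne_zero'.2 (hpos 0))
      exact h3.congr_deriv (by simp)
    have h2 := ((hasDerivAt_id (0 : ℝ)).smul_const v).const_add q
    refine (h1.smul h2).congr_deriv ?_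
    simp [hq]
  · have hn : ‖q + t • v‖ = √(‖q‖ ^ 2 + t ^ 2 * ‖v‖ ^ 2) := by
      rw [← Real.sqrt_sq (norm_nonneg (q + t • v)), norm_add_sq_real, inner_smul_right, hv,
        norm_smul]
      simp [mul_pow]
    rw [norm_smul, hn, Real.norm_of_nonneg (by positivity)]
    have := (Real.sqrt_pos.2 (hpos t)).ne'
    field_simp

theorem mem_tangentVectors_of_inner_eq_zero {S : Set E3} (hsym : IsSphericallySymmetricSet S)
    {q v : E3} (hqS : q ∈ S) (hq : q ≠ 0) (hv : inner ℝ q v = 0) : v ∈ tangentVectors S q := by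
  obtain ⟨γ, h0, hd, hn⟩ := exists_curve_on_sphere hq hv
  exact ⟨γ, h0, hd, .of_forall fun t => hsym.mem_of_norm_eq hqS (hn t).symm⟩

/-- Velocities of curves in S lie in the kernel of dF, which already contains the plane orthogonal
to q. One more velocity transverse to that plane would force dF = 0. -/
theorem inner_eq_zero_of_mem_tangentVectors {S : Set E3} (hS : IsCompactEmbeddedSurface S)
    (hsym : IsSphericallySymmetricSet S) {q v : E3} (hqS : q ∈ S) (hq : q ≠ 0)
    (hv : v ∈ tangentVectors S q) : inner ℝ q v = 0 := by
  obtain ⟨U, hU, hqU, F, hF, hd, hSU⟩ := hS.locallyRegular q hqS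
  have hFd : HasFDerivAt F (fderiv ℝ F q) q :=
    ((hF.contDiffAt (hU.mem_nhds hqU)).differentiableAt (by simp)).hasFDerivAt
  have hker : ∀ w ∈ tangentVectors S q, fderiv ℝ F q w = 0 := by
    rintro w ⟨γ, h0, hγ, hγS⟩
    have h1 : HasDerivAt (F ∘ γ) (fderiv ℝ F q w) 0 :=
      HasFDerivAt.comp_hasDerivAt (0 : ℝ) (by rwa [h0]) hγ
    have h2 : F ∘ γ =ᶠ[𝓝 0] fun _ => 0 := by
      have hc : ∀ᶠ t in 𝓝 (0 : ℝ), γ t ∈ U :=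
        hγ.continuousAt.eventually_mem (by rw [h0]; exact hU.mem_nhds hqU)
      filter_upwards [hγS, hc] with t ht ht'
      exact (hSU.subset ⟨ht, ht'⟩).2
    exact h1.unique ((hasDerivAt_const (0 : ℝ) (0 : ℝ)).congr_of_eventuallyEq h2)
  by_contra hne
  refine hd q hqU (ContinuousLinearMap.ext fun w => ?_)
  have h3 := hker _ (mem_tangentVectors_of_inner_eq_zero hsym hqS hq
    (v := w - (inner ℝ q w / inner ℝ q v) • v)
    (by rw [inner_sub_right, inner_smul_right]; field_simp; simp))
  rw [map_sub, map_smul, hker v hv] at h3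
  simpa using h3

theorem tensorApply_radial {T : Tensor2} {u a : ℝ → ℝ} {y : E3} (hT : IsRadialTensorNear T u a y)
    (w v : E3) :
    tensorApply T y w v = a ‖y‖ * inner ℝ w v +
      (u ‖y‖ - a ‖y‖) / ‖y‖ ^ 2 * (inner ℝ y w * inner ℝ y v) := by
  simp only [tensorApply, hT.self_of_nhds.2, PiLp.inner_apply, Fin.sum_univ_three, kron]
  simp
  ring

/-- On the sphere through p, a unit normal is a multiple c(q)q with c(q)² fixed. Continuity fixes
the sign near p, so N is linear along the sphere. Only tangential derivatives are determined, since
N is prescribed on S alone. -/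
theorem exists_normal_eq_smul {g : Tensor2} {α : ℝ → ℝ} {S : Set E3} {N : E3 → E3} {p : E3}
    (hsym : IsSphericallySymmetricSet S) (hp : p ∈ S) (hp0 : p ≠ 0)
    (hg : IsRadialTensorNear g (fun _ => 1) α p) (hα : α ‖p‖ ≠ 0)
    (hN : IsLocalUnitNormal g S p N) :
    ∃ c : ℝ, c ^ 2 = (‖p‖ ^ 2)⁻¹ ∧ N p = c • p ∧
      ∀ v, inner ℝ p v = 0 → fderiv ℝ N p v = c • v := by
  have hpn : ‖p‖ ≠ 0 := norm_ne_zero_iff.2 hp0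
  let c : E3 → ℝ := fun q => inner ℝ q (N q) / ‖q‖ ^ 2
  have hev : ∀ᶠ q in 𝓝 p, ‖q‖ = ‖p‖ → N q = c q • q ∧ c q ^ 2 = (‖p‖ ^ 2)⁻¹ := by
    filter_upwards [eventually_nhdsWithin_iff.1 hN.unit, eventually_nhdsWithin_iff.1 hN.normal,
      eventually_eventually_nhds.2 hg] with q h1 h2 h3 hq
    have h3 : IsRadialTensorNear g (fun _ => 1) α q := h3
    have hqS := hsym.mem_of_norm_eq hp hq.symm
    have hq0 : q ≠ 0 := norm_ne_zero_iff.1 (by rwa [hq])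
    have hαq : α ‖q‖ ≠ 0 := by rwa [hq]
    have hqn : ‖q‖ ≠ 0 := by rwa [hq]
    have hperp : inner ℝ q (N q - c q • q) = 0 := by
      rw [inner_sub_right, inner_smul_right, real_inner_self_eq_norm_sq]
      simp only [c]
      field_simp
      simp
    have h4 := h2 hqS _ (mem_tangentVectors_of_inner_eq_zero hsym hqS hq0 hperp)
    rw [tensorApply_radial h3, hperp, mul_zero, mul_zero, add_zero] at h4
    have h5 : inner ℝ (N q) (N q - c q • q) = 0 := (mul_eq_zero.1 h4).resolve_left hαq
    have h6 : N q - c q • q = 0 := by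
      rw [← inner_self_eq_zero (𝕜 := ℝ)]
      nth_rewrite 1 [sub_eq_add_neg]
      rw [inner_add_left, h5, ← neg_smul, inner_smul_left, hperp]
      simp
    have h7 : N q = c q • q := sub_eq_zero.1 h6
    refine ⟨h7, ?_⟩
    have h8 := h1 hqS
    rw [tensorApply_radial h3] at h8
    rw [h7] at h8
    simp only [inner_smul_left, inner_smul_right, real_inner_self_eq_norm_sq] at h8
    rw [← hq]
    field_simp at h8 ⊢
    simp at h8
    linarith
  obtain ⟨hNp, hcp⟩ := hev.self_of_nhds rfl
  refine ⟨c p, hcp, hNp, fun v hv => ?_⟩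
  obtain ⟨γ, h0, hd, hn⟩ := exists_curve_on_sphere hp0 hv
  have hγ : Filter.Tendsto γ (𝓝 0) (𝓝 p) := by
    have := hd.continuousAt.tendsto
    rwa [h0] at this
  have hcc : ContinuousAt c p :=
    (continuousAt_id.inner hN.smooth.continuousAt).div (continuousAt_id.norm.pow 2) (by simpa)
  have hsame : ∀ᶠ t in 𝓝 (0 : ℝ), N (γ t) = c p • γ t := by
    have hpos : 0 < c p * c p := by
      rw [← sq, hcp]; positivity
    have hsign : ∀ᶠ q in 𝓝 p, 0 < c q * c p :=
      (hcc.mul continuousAt_const).eventually_const_lt hpos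
    filter_upwards [hγ.eventually hev, hγ.eventually hsign] with t ht hs
    obtain ⟨e1, e2⟩ := ht (hn t)
    rcases sq_eq_sq_iff_eq_or_eq_neg.1 (e2.trans hcp.symm) with e | e
    · rw [e1, e]
    · rw [e] at hs; linarith
  have hNd : HasFDerivAt N (fderiv ℝ N p) (γ 0) := by
    rw [h0]; exact (hN.smooth.differentiableAt (by simp)).hasFDerivAt
  exact (hNd.comp_hasDerivAt (0 : ℝ) hd).unique ((hd.const_smul (c p)).congr_of_eventuallyEq hsame)

/-- For c = ±1/ρ the factor is ±r'/r, since r = ρ√α gives r'/r = 1/ρ + α'/(2α): the sphere is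
umbilic. -/
theorem secondFundamentalForm_sphere {g : Tensor2} {α : ℝ → ℝ} {α' ρ c : ℝ} {N : E3 → E3}
    (hρ : 0 < ρ) (hg : IsRadialTensorNear g (fun _ => 1) α (EuclideanSpace.single 0 ρ))
    (h0 : α ρ ≠ 0) (hα : HasDerivAt α α' ρ)
    (hN : DifferentiableAt ℝ N (EuclideanSpace.single 0 ρ))
    (hNp : N (EuclideanSpace.single 0 ρ) = c • EuclideanSpace.single 0 ρ) {X : E3} (hX : X 0 = 0)
    (hNX : fderiv ℝ N (EuclideanSpace.single 0 ρ) X = c • X) (Y : E3) :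
    secondFundamentalForm g N (EuclideanSpace.single 0 ρ) X Y =
      c * (1 + ρ * α' / (2 * α ρ)) * tensorApply g (EuclideanSpace.single 0 ρ) X Y := by
  have hn := norm_single_zero hρ
  set p : E3 := EuclideanSpace.single 0 ρ with hp
  have hΓ := christoffel_radial (α' := α') hg (by rwa [hn]) (by rwa [hn])
  rw [hn] at hΓ
  have hpd : ∀ l, ∑ i, X i * pd i (fun y => N y l) p = c * X l := fun l => by
    have h1 : HasFDerivAt (fun y => N y l)
        ((EuclideanSpace.proj l : E3 →L[ℝ] ℝ).comp (fderiv ℝ N p)) p :=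
      (EuclideanSpace.proj l : E3 →L[ℝ] ℝ).hasFDerivAt.comp p hN.hasFDerivAt
    have h2 : X = ∑ i, X i • (EuclideanSpace.single i 1 : E3) := by
      ext j; simp [Finset.sum_apply, Pi.single_apply]
    have h3 : fderiv ℝ N p X = ∑ i, X i • fderiv ℝ N p (EuclideanSpace.single i 1) := by
      conv_lhs => rw [h2, map_sum]
      simp only [map_smul]
    have h4 := congrArg (fun w : E3 => w l) (h3.symm.trans hNX)
    simp only [pd, h1.fderiv]
    simpa using h4
  have hcov : ∀ l, covDerivVector g N p X l = c * (1 + ρ * α' / (2 * α ρ)) * X l := fun l => by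
    have h4 : ∀ i, ∑ j, christoffel g l i j p * N p j = c * ρ * christoffel g l i 0 p := fun i => by
      rw [hNp, Fin.sum_univ_three]
      simp [hp]
      ring
    rw [covDerivVector]
    simp only [h4]
    simp only [mul_add, Finset.sum_add_distrib, hpd, hΓ]
    fin_cases l <;> simp [hX, hp, kron] <;> field_simp
  simp only [secondFundamentalForm, tensorApply, hcov, Finset.mul_sum]
  exact Finset.sum_congr rfl fun l _ => Finset.sum_congr rfl fun j _ => by ring

theorem trapped_sphere {g k : Tensor2} {Ω S : Set E3} {α u b : ℝ → ℝ} {α' ρ : ℝ} (hρ : 0 < ρ)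
    (hS : IsCompactEmbeddedSurface S) (hsym : IsSphericallySymmetricSet S)
    (hmem : EuclideanSpace.single 0 ρ ∈ S) (htr : IsTrapped g k Ω S)
    (hg : IsRadialTensorNear g (fun _ => 1) α (EuclideanSpace.single 0 ρ))
    (hk : IsRadialTensorNear k u b (EuclideanSpace.single 0 ρ))
    (h0 : 0 < α ρ) (hα : HasDerivAt α α' ρ) :
    ρ * b ρ / α ρ < -|1 + ρ * α' / (2 * α ρ)| := by
  have hn := norm_single_zero hρ
  obtain ⟨N, e₁, e₂, hN, he, h1, h2⟩ := htr.2 _ hmem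
  have hp0 := hg.self_of_nhds.1
  obtain ⟨c, hc, hNp, hNv⟩ := exists_normal_eq_smul hsym hmem hp0 hg (by rw [hn]; exact h0.ne') hN
  have i1 := inner_eq_zero_of_mem_tangentVectors hS hsym hmem hp0 he.mem₁
  have i2 := inner_eq_zero_of_mem_tangentVectors hS hsym hmem hp0 he.mem₂
  have z {e : E3} (h : inner ℝ (EuclideanSpace.single 0 ρ : E3) e = 0) : e 0 = 0 := by
    simpa [EuclideanSpace.inner_single_left, hρ.ne'] using h
  have hsf {e : E3} (h : inner ℝ (EuclideanSpace.single 0 ρ : E3) e = 0) :=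
    secondFundamentalForm_sphere hρ hg h0.ne' hα (hN.smooth.differentiableAt (by simp)) hNp (z h)
      (hNv e h) e
  have hkk {e : E3} (h : inner ℝ (EuclideanSpace.single 0 ρ : E3) e = 0)
      (hu : tensorApply g (EuclideanSpace.single 0 ρ) e e = 1) :
      tensorApply k (EuclideanSpace.single 0 ρ) e e = b ρ / α ρ := by
    rw [tensorApply_radial hg, h, hn] at hu
    rw [tensorApply_radial hk, h, hn]
    simp only [mul_zero, add_zero] at hu ⊢
    rw [eq_div_iff h0.ne']
    linear_combination b ρ * hu
  rw [hsf i1, hsf i2, he.unit₁, he.unit₂, hkk i1 he.unit₁, hkk i2 he.unit₂] at h1 h2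
  rw [hn] at hc
  have hcρ : c * ρ = 1 ∨ c * ρ = -1 := by
    rw [← mul_self_eq_one_iff]
    calc c * ρ * (c * ρ) = c ^ 2 * ρ ^ 2 := by ring
      _ = 1 := by rw [hc]; field_simp
  generalize 1 + ρ * α' / (2 * α ρ) = w at *
  rw [mul_div_assoc]
  generalize b ρ / α ρ = a at *
  have h3 : a + c * w < 0 := by linarith
  have h4 : a - c * w < 0 := by linarith
  have h5 := mul_neg_of_pos_of_neg hρ h3
  have h6 := mul_neg_of_pos_of_neg hρ h4
  rcases hcρ with e | e
  · have e5 : ρ * (a + c * w) = ρ * a + w := by linear_combination w * e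
    have e6 : ρ * (a - c * w) = ρ * a - w := by linear_combination -w * e
    rw [lt_neg]
    exact abs_lt.2 ⟨by linarith, by linarith⟩
  · have e5 : ρ * (a + c * w) = ρ * a - w := by linear_combination w * e
    have e6 : ρ * (a - c * w) = ρ * a + w := by linear_combination -w * e
    rw [lt_neg]
    exact abs_lt.2 ⟨by linarith, by linarith⟩

/-! ### Reduction of the data to radial functions, and the energy bound -/

theorem lintegral_ball_radial {e : ℝ → ℝ} {R ρ : ℝ} (he : ContinuousOn e (Set.Ico 0 R))
    (hnn : ∀ t, 0 ≤ e t) (hρ : ρ ∈ Set.Ioo 0 R) :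
    ∫⁻ x in ball (0 : E3) ρ, ENNReal.ofReal (e ‖x‖) =
      ENNReal.ofReal (3 * volume.real (ball (0 : E3) 1) * ∫ t in (0 : ℝ)..ρ, t ^ 2 * e t) := by
  have hint : IntegrableOn (fun x : E3 => e ‖x‖) (ball 0 ρ) volume := by
    refine IntegrableOn.mono_set ?_ ball_subset_closedBall
    refine ContinuousOn.integrableOn_compact (isCompact_closedBall 0 ρ) ?_
    refine he.comp continuous_norm.continuousOn fun x hx => ⟨norm_nonneg x, ?_⟩
    exact (mem_closedBall_zero_iff.1 hx).trans_lt hρ.2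
  rw [← ofReal_integral_eq_lintegral_ofReal hint (.of_forall fun x => hnn _)]
  congr 1
  have h1 : ∫ x in ball (0 : E3) ρ, e ‖x‖ = ∫ x : E3, (Set.Iio ρ).indicator e ‖x‖ := by
    rw [← integral_indicator measurableSet_ball]
    congr 1
    ext x
    by_cases h : ‖x‖ < ρ <;> simp [h]
  rw [h1, integral_fun_norm_addHaar]
  have h2 : ∫ y in Set.Ioi (0 : ℝ), y ^ (Module.finrank ℝ E3 - 1) • (Set.Iio ρ).indicator e y =
      ∫ t in (0 : ℝ)..ρ, t ^ 2 * e t := by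
    have : ∀ y, y ^ (Module.finrank ℝ E3 - 1) • (Set.Iio ρ).indicator e y =
        (Set.Iio ρ).indicator (fun y => y ^ 2 * e y) y := fun y => by
      by_cases h : y < ρ <;> simp [h]
    simp only [this]
    rw [setIntegral_indicator measurableSet_Iio, Set.Ioi_inter_Iio,
      ← integral_Ioc_eq_integral_Ioo, ← intervalIntegral.integral_of_le hρ.1.le]
  rw [h2]
  simp
  ring

theorem contDiffOn_comp_single {f : E3 → ℝ} {R : ℝ} (i : Fin 3)
    (hf : ContDiffOn ℝ ∞ f (ball 0 R)) :
    ContDiffOn ℝ ∞ (fun t : ℝ => f (EuclideanSpace.single i t)) (Set.Ioo (-R) R) := by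
  have h : ContDiff ℝ ∞ fun t : ℝ => (EuclideanSpace.single i t : E3) := by
    have : (fun t : ℝ => (EuclideanSpace.single i t : E3)) =
        fun t => t • (EuclideanSpace.single i 1 : E3) := by
      ext t j
      simp
    rw [this]
    fun_prop
  refine hf.comp h.contDiffOn fun t ht => ?_
  simpa [abs_lt] using ht

theorem hasDerivAt_of_contDiffOn {f : ℝ → ℝ} {U : Set ℝ} (hU : IsOpen U) (hf : ContDiffOn ℝ ∞ f U)
    {t : ℝ} (ht : t ∈ U) :
    HasDerivAt f (deriv f t) t ∧ HasDerivAt (deriv f) (deriv (deriv f) t) t :=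
  ⟨((hf.contDiffAt (hU.mem_nhds ht)).differentiableAt (by simp)).hasDerivAt,
    (((hf.deriv_of_isOpen hU (m := ∞) (by simp)).contDiffAt
      (hU.mem_nhds ht)).differentiableAt (by simp)).hasDerivAt⟩

/-- The given `r` carries no regularity assumption. The ratio r²/ρ² is a tangential Cartesian
component of g on an axis, and this component is smooth across the origin. -/
theorem SphericalData.HasSphericalMetricForm.isRadialTensorNear {g : Tensor2} {r : ℝ → ℝ} {R : ℝ}
    (hg : HasSphericalMetricForm g r R) {y : E3} (hy : y ∈ ball (0 : E3) R) (hy0 : y ≠ 0) :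
    IsRadialTensorNear g (fun _ => 1) (fun t => g (EuclideanSpace.single 0 t) 1 1) y := by
  filter_upwards [isOpen_ball.mem_nhds hy, isOpen_ne.mem_nhds hy0] with z hz hz0
  refine ⟨hz0, fun i j => ?_⟩
  have hzn : 0 < ‖z‖ := norm_pos_iff.2 hz0
  have hn := norm_single_zero hzn
  have h1 := hg.2 (EuclideanSpace.single 0 ‖z‖) (by simpa [hn] using hz)
    (norm_pos_iff.1 (by rwa [hn])) 1 1
  rw [hn] at h1
  simp at h1
  rw [hg.2 z hz hz0, h1, kron]
  ring

theorem SphericalData.HasSphericalTensorForm.isRadialTensorNear {k : Tensor2} {kρρ kϑϑ : ℝ → ℝ}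
    {R : ℝ} (hk : HasSphericalTensorForm k kρρ kϑϑ R) {y : E3} (hy : y ∈ ball (0 : E3) R)
    (hy0 : y ≠ 0) :
    IsRadialTensorNear k (fun t => k (EuclideanSpace.single 0 t) 0 0)
      (fun t => k (EuclideanSpace.single 0 t) 1 1) y := by
  filter_upwards [isOpen_ball.mem_nhds hy, isOpen_ne.mem_nhds hy0] with z hz hz0
  refine ⟨hz0, fun i j => ?_⟩
  have hzn : 0 < ‖z‖ := norm_pos_iff.2 hz0
  have hn := norm_single_zero hzn
  have hm : (EuclideanSpace.single 0 ‖z‖ : E3) ∈ ball (0 : E3) R := by simpa [hn] using hz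
  have hm0 : (EuclideanSpace.single 0 ‖z‖ : E3) ≠ 0 := norm_pos_iff.1 (by rwa [hn])
  have h1 := hk _ hm hm0 1 1
  have h0 := hk _ hm hm0 0 0
  rw [hn] at h1 h0
  simp at h1 h0
  rw [hk z hz hz0, h1, h0, kron]
  field_simp
  ring

theorem SphericalData.IsRadialOn.eventuallyEq {ψ : E3 → ℝ} {R : ℝ} (h : IsRadialOn ψ R) {y : E3}
    (hy : y ∈ ball (0 : E3) R) (hy0 : y ≠ 0) :
    ψ =ᶠ[𝓝 y] fun z => (fun t => ψ (EuclideanSpace.single 0 t)) ‖z‖ := by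
  filter_upwards [isOpen_ball.mem_nhds hy, isOpen_ne.mem_nhds hy0] with z hz hz0
  have hn := norm_single_zero (norm_pos_iff.2 hz0)
  exact h z hz _ (by simpa [hn] using hz) hn.symm

theorem single_zero_eq_zero (i : Fin 3) : (EuclideanSpace.single i (0 : ℝ) : E3) = 0 := by
  ext j
  simp

/-- On the axis of the same index this component is the radial one, hence equal to 1 off the origin;
continuity gives the value at 0. It supplies r'(0) = 1. -/
theorem SphericalData.HasSphericalMetricForm.apply_zero {g : Tensor2} {r : ℝ → ℝ} {R : ℝ}
    (hR : 0 < R) (hg : HasSphericalMetricForm g r R) (hsm : SmoothTensorOn g (ball 0 R)) :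
    g 0 1 1 = 1 := by
  have hc : ContinuousAt (fun t : ℝ => g (EuclideanSpace.single 1 t) 1 1) 0 :=
    (contDiffOn_comp_single 1 (hsm 1 1)).continuousOn.continuousAt
      (Ioo_mem_nhds (by linarith) hR)
  have h1 : Filter.Tendsto (fun t : ℝ => g (EuclideanSpace.single 1 t) 1 1) (𝓝[>] 0)
      (𝓝 (g (EuclideanSpace.single 1 (0 : ℝ)) 1 1)) := hc.tendsto.mono_left nhdsWithin_le_nhds
  have h2 : Filter.Tendsto (fun t : ℝ => g (EuclideanSpace.single 1 t) 1 1) (𝓝[>] 0) (𝓝 1) := by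
    refine tendsto_const_nhds.congr' ?_
    filter_upwards [Ioo_mem_nhdsGT hR] with t ht
    have ht0 : t ≠ 0 := ht.1.ne'
    rw [hg.2 _ (by simpa [abs_of_pos ht.1] using ht.2) (by simpa using ht0)]
    simp
    field_simp
    ring
  have h3 := tendsto_nhds_unique h1 h2
  rwa [single_zero_eq_zero] at h3

/-- With r = t√α and κ = tb/√α everything is expressed by restrictions of smooth Cartesian
components to an axis, defined on (-R, R), so regularity and initial values at t = 0 come for free.
-/
theorem radialConstraints_of_constraints {R δ : ℝ} (hR : 0 < R) {g k : Tensor2} {ψ₀ ψ₁ : E3 → ℝ}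
    {r kρρ kϑϑ : ℝ → ℝ} (hgm : IsRiemannianMetricOn g (ball 0 R))
    (hks : IsSymmetricTensorOn k (ball 0 R)) (hg : HasSphericalMetricForm g r R)
    (hk : HasSphericalTensorForm k kρρ kϑϑ R) (hψ₀ : ContDiffOn ℝ ∞ ψ₀ (ball 0 R))
    (hψ₀r : IsRadialOn ψ₀ R) (hψ₁ : ContDiffOn ℝ ∞ ψ₁ (ball 0 R))
    (hc : EinsteinScalarConstraintsOn g k ψ₀ ψ₁ (ball 0 R))
    {α u b φ ψ : ℝ → ℝ} (hαd : α = fun t => g (EuclideanSpace.single 0 t) 1 1)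
    (hud : u = fun t => k (EuclideanSpace.single 0 t) 0 0)
    (hbd : b = fun t => k (EuclideanSpace.single 0 t) 1 1)
    (hφd : φ = fun t => ψ₀ (EuclideanSpace.single 0 t))
    (hψd : ψ = fun t => ψ₁ (EuclideanSpace.single 0 t))
    (hG : ∀ ρ ∈ Set.Ioo 0 R, ∫ t in (0 : ℝ)..ρ,
      t ^ 2 * (u t ^ 2 + 2 * b t ^ 2 + deriv φ t ^ 2 + ψ t ^ 2) ≤ δ * ρ) :
    RadialConstraints R δ (fun t => t * √(α t)) (fun t => √(α t) + t * deriv α t / (2 * √(α t)))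
      (fun t => deriv α t / √(α t) + t * deriv (deriv α) t / (2 * √(α t)) -
        t * deriv α t ^ 2 / (4 * α t * √(α t)))
      (fun t => t * b t / √(α t)) u b (deriv φ) ψ
      (fun ρ => ∫ t in (0 : ℝ)..ρ, t ^ 2 * (u t ^ 2 + 2 * b t ^ 2 + deriv φ t ^ 2 + ψ t ^ 2)) := by
  set I := Set.Ioo (-R) R with hI
  have hIo : IsOpen I := isOpen_Ioo
  have hsub : Set.Ico 0 R ⊆ I := fun t ht => ⟨by linarith [ht.1], ht.2⟩
  have hsub' : Set.Ioo 0 R ⊆ I := fun t ht => hsub (Set.Ioo_subset_Ico_self ht)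
  have sα : ContDiffOn ℝ ∞ α I := hαd ▸ contDiffOn_comp_single 0 (hgm.1 1 1)
  have su : ContDiffOn ℝ ∞ u I := hud ▸ contDiffOn_comp_single 0 (hks.1 0 0)
  have sb : ContDiffOn ℝ ∞ b I := hbd ▸ contDiffOn_comp_single 0 (hks.1 1 1)
  have sφ : ContDiffOn ℝ ∞ φ I := hφd ▸ contDiffOn_comp_single 0 hψ₀
  have sψ : ContDiffOn ℝ ∞ ψ I := hψd ▸ contDiffOn_comp_single 0 hψ₁
  have dα (t) (ht : t ∈ I) := hasDerivAt_of_contDiffOn hIo sα ht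
  have du (t) (ht : t ∈ I) := (hasDerivAt_of_contDiffOn hIo su ht).1
  have db (t) (ht : t ∈ I) := (hasDerivAt_of_contDiffOn hIo sb ht).1
  have dφ (t) (ht : t ∈ I) := hasDerivAt_of_contDiffOn hIo sφ ht
  have hα : ∀ t ∈ I, 0 < α t := fun t ht => by
    rw [hαd]
    exact (hgm.2 _ (by simpa [hI, abs_lt] using ht)).diag_pos
  have hα0 : α 0 = 1 := by
    simp only [hαd, single_zero_eq_zero]
    exact hg.apply_zero hR hgm.1
  have dsq (t) (ht : t ∈ I) := (dα t ht).1.sqrt (hα t ht).ne'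
  have hsq (t) (ht : t ∈ I) : 0 < √(α t) := Real.sqrt_pos.2 (hα t ht)
  have hss (t) (ht : t ∈ I) : √(α t) ^ 2 = α t := Real.sq_sqrt (hα t ht).le
  have hmem (t) (ht : t ∈ Set.Ioo 0 R) : (EuclideanSpace.single 0 t : E3) ∈ ball (0 : E3) R := by
    simpa [abs_of_pos ht.1] using ht.2
  have hne (t) (ht : t ∈ Set.Ioo 0 R) : (EuclideanSpace.single 0 t : E3) ≠ 0 := by
    simpa using ht.1.ne'
  have rg (t) (ht : t ∈ Set.Ioo 0 R) :
      IsRadialTensorNear g (fun _ => 1) α (EuclideanSpace.single 0 t) :=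
    hαd ▸ hg.isRadialTensorNear (hmem t ht) (hne t ht)
  have rk (t) (ht : t ∈ Set.Ioo 0 R) : IsRadialTensorNear k u b (EuclideanSpace.single 0 t) :=
    hud ▸ hbd ▸ hk.isRadialTensorNear (hmem t ht) (hne t ht)
  have hpdψ (t) (ht : t ∈ Set.Ioo 0 R) (m : Fin 3) :
      pd m ψ₀ (EuclideanSpace.single 0 t) = if m = 0 then deriv φ t else 0 := by
    have hn := norm_single_zero ht.1
    have ht0 : t ≠ 0 := ht.1.ne'
    rw [pd_radial (hne t ht) (f := φ) (f' := deriv φ t)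
      (by rw [hn]; exact (dφ t (hsub' ht)).1)
      (hφd ▸ hψ₀r.eventuallyEq (hmem t ht) (hne t ht)), hn]
    fin_cases m <;> simp [ht0]
  have cG : ContinuousOn (fun t => t ^ 2 * (u t ^ 2 + 2 * b t ^ 2 + deriv φ t ^ 2 + ψ t ^ 2)) I := by
    have c1 := su.continuousOn
    have c2 := sb.continuousOn
    have c3 := sψ.continuousOn
    have c4 : ContinuousOn (deriv φ) I := fun t ht => (dφ t ht).2.continuousAt.continuousWithinAt
    fun_prop
  have dG : ∀ t ∈ I, HasDerivAt (fun ρ => ∫ t in (0 : ℝ)..ρ,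
      t ^ 2 * (u t ^ 2 + 2 * b t ^ 2 + deriv φ t ^ 2 + ψ t ^ 2))
      (t ^ 2 * (u t ^ 2 + 2 * b t ^ 2 + deriv φ t ^ 2 + ψ t ^ 2)) t := fun t ht => by
    have h0 : (0 : ℝ) ∈ I := ⟨by linarith, hR⟩
    refine intervalIntegral.integral_hasDerivAt_right ?_
      (cG.stronglyMeasurableAtFilter hIo t ht) (cG.continuousAt (hIo.mem_nhds ht))
    exact (cG.mono ((convex_Ioo (-R) R).ordConnected.uIcc_subset h0 ht)).intervalIntegrable
  constructor
  case hasDerivAt_r =>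
    intro t ht
    refine ((hasDerivAt_id t).mul (dsq t (hsub ht))).congr_deriv ?_
    simp
    ring
  case hasDerivAt_r₁ =>
    intro t ht
    have ht := hsub ht
    have h1 := hsq t ht
    have h2 := hα t ht
    refine ((dsq t ht).add (((hasDerivAt_id t).mul (dα t ht).2).div ((dsq t ht).const_mul 2)
      (by positivity))).congr_deriv ?_
    simp only [Pi.mul_apply, id]
    rw [← hss t ht, Real.sqrt_sq h1.le]
    field_simp
    ring
  case r_zero => simp
  case r₁_zero => simp [hα0]
  case continuousOn_κ =>
    intro t ht
    have ht := hsub ht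
    exact (((hasDerivAt_id t).mul (db t ht)).div (dsq t ht)
      (hsq t ht).ne').continuousAt.continuousWithinAt
  case κ_zero => simp
  case momentum =>
    intro t ht
    have hti := hsub' ht
    have h1 := hsq t hti
    have h2 := hα t hti
    have ht0 : 0 < t := ht.1
    have hev : ∀ᶠ s in 𝓝 t, α s ≠ 0 := by
      filter_upwards [hIo.mem_nhds hti] with s hs using (hα s hs).ne'
    have hm := hc.momentum _ (hmem t ht) 0
    rw [divergence_radial ht.1 (rg t ht) (rk t ht) h2.ne' (dα t hti).1 (du t hti) (db t hti),
      pd_metricTrace_radial ht.1 (rg t ht) (rk t ht) hev (dα t hti).1 (du t hti) (db t hti),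
      hpdψ t ht, if_pos rfl] at hm
    have hψt : ψ₁ (EuclideanSpace.single 0 t) = ψ t := by rw [hψd]
    rw [hψt] at hm
    refine (((hasDerivAt_id t).mul (db t hti)).div (dsq t hti) h1.ne').congr_deriv ?_
    rw [← hm]
    simp only [Pi.mul_apply, id]
    have e := hss t hti
    generalize √(α t) = s at *
    rw [← e]
    field_simp
    ring
  case hamiltonian =>
    intro t ht
    have hti := hsub' ht
    have h1 := hsq t hti
    have h2 := hα t hti
    have ht0 : 0 < t := ht.1
    have hev : ∀ᶠ s in 𝓝 t, α s ≠ 0 ∧ HasDerivAt α (deriv α s) s := by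
      filter_upwards [hIo.mem_nhds hti] with s hs using ⟨(hα s hs).ne', (dα s hs).1⟩
    have hm := hc.hamiltonian _ (hmem t ht)
    have hsc := scalarCurvature_radial ht.1 (rg t ht) hev (dα t hti).2
    rw [metricTrace_single ht.1 h2.ne' (rg t ht) (rk t ht),
      tensorNormSq_single ht.1 h2.ne' (rg t ht) (rk t ht),
      gradNormSq_single ht.1 h2.ne' (rg t ht) (hpdψ t ht)] at hm
    have hψt : ψ₁ (EuclideanSpace.single 0 t) = ψ t := by rw [hψd]
    rw [hψt] at hm
    have e := hss t hti
    generalize √(α t) = s at *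
    rw [← e] at hm hsc ⊢
    rw [mul_pow, ← hm]
    rw [mul_sub (t ^ 2 * s ^ 2), mul_add (t ^ 2 * s ^ 2), hsc]
    field_simp
    ring
  case r_mul_κ =>
    intro t ht
    have h1 := hsq t (hsub' ht)
    field_simp
  case continuousOn_G => exact fun t ht => (dG t (hsub ht)).continuousAt.continuousWithinAt
  case G_zero => simp
  case hasDerivAt_G => exact fun t ht => dG t (hsub' ht)
  case G_le => exact hG

/-- The Euclidean size of the component matrix, not the g-norm, is what the component-wise Sobolev
norm controls; this is the source of the weights 1 and 2 in the energy. -/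
theorem sum_sq_radial_tensor {T : Tensor2} {u a : ℝ → ℝ} {y : E3} (hT : IsRadialTensorNear T u a y) :
    ∑ i, ∑ j, T y i j ^ 2 = u ‖y‖ ^ 2 + 2 * a ‖y‖ ^ 2 := by
  have hn : ‖y‖ ≠ 0 := by simpa using hT.self_of_nhds.1
  have e : ∀ i, ∑ j, T y i j ^ 2 = a ‖y‖ ^ 2 +
      (u ‖y‖ ^ 2 - a ‖y‖ ^ 2) / ‖y‖ ^ 2 * (y i * y i) := fun i => by
    have e' : ∀ j, T y i j ^ 2 = kron i j * (a ‖y‖ ^ 2 * kron i j +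
        2 * a ‖y‖ * ((u ‖y‖ - a ‖y‖) / ‖y‖ ^ 2) * (y i * y j)) +
        ((u ‖y‖ - a ‖y‖) / ‖y‖ ^ 2) ^ 2 * (y i * y i) * (y j * y j) := fun j => by
      rw [hT.self_of_nhds.2]
      ring
    rw [Finset.sum_congr rfl fun j _ => e' j, Finset.sum_add_distrib, sum_kron_mul,
      ← Finset.mul_sum, norm_sq_eq_sum_mul]
    simp only [kron, if_true]
    field_simp
    ring
  rw [Finset.sum_congr rfl fun i _ => e i, Finset.sum_add_distrib, Finset.sum_const,
    ← Finset.mul_sum, norm_sq_eq_sum_mul]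
  simp
  field_simp
  ring

theorem enorm_sq_eq_ofReal (x : ℝ) : ‖x‖ₑ ^ 2 = ENNReal.ofReal (x ^ 2) := by
  rw [← ofReal_norm, ← ENNReal.ofReal_pow (norm_nonneg _), Real.norm_eq_abs, sq_abs]

theorem aemeasurable_enorm_sq {f : E3 → ℝ} {ρ : ℝ} (hf : ContinuousOn f (ball 0 ρ)) :
    AEMeasurable (fun x => ‖f x‖ₑ ^ 2) (volume.restrict (ball 0 ρ)) :=
  (hf.aemeasurable measurableSet_ball).enorm.pow_const 2

theorem radial_energy_le {R ε : ℝ} (hε : 0 < ε) {k : Tensor2} {ψ₀ ψ₁ : E3 → ℝ}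
    {kρρ kϑϑ : ℝ → ℝ} (hks : IsSymmetricTensorOn k (ball 0 R))
    (hk : HasSphericalTensorForm k kρρ kϑϑ R) (hψ₀ : ContDiffOn ℝ ∞ ψ₀ (ball 0 R))
    (hψ₀r : IsRadialOn ψ₀ R) (hψ₁ : ContDiffOn ℝ ∞ ψ₁ (ball 0 R)) (hψ₁r : IsRadialOn ψ₁ R)
    {u b φ ψ : ℝ → ℝ} (hud : u = fun t => k (EuclideanSpace.single 0 t) 0 0)
    (hbd : b = fun t => k (EuclideanSpace.single 0 t) 1 1)
    (hφd : φ = fun t => ψ₀ (EuclideanSpace.single 0 t))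
    (hψd : ψ = fun t => ψ₁ (EuclideanSpace.single 0 t))
    (hN : tensorSobolevNormOn (1 / 2) (ball 0 R) k + sobolevNormOn (3 / 2) (ball 0 R) ψ₀ +
      sobolevNormOn (1 / 2) (ball 0 R) ψ₁ ≤ ENNReal.ofReal ε) {ρ : ℝ} (hρ : ρ ∈ Set.Ioo 0 R) :
    3 * volume.real (ball (0 : E3) 1) * ∫ t in (0 : ℝ)..ρ,
      t ^ 2 * (u t ^ 2 + 2 * b t ^ 2 + deriv φ t ^ 2 + ψ t ^ 2) ≤
      morreyConst * ρ * ((10 + 12 * Real.pi ^ 2) * (2 * ε) ^ 2) := by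
  have hsub : Set.Ico 0 R ⊆ Set.Ioo (-R) R := fun t ht => ⟨by linarith [ht.1, ht.2], ht.2⟩
  have hC := morreyConst_pos
  -- Doubling turns the bound by ε into a strict one, so that each infimum over extensions is
  -- undercut by an actual extension.
  set M : ℝ≥0∞ := ENNReal.ofReal (2 * ε) with hM
  have hlt {x : ℝ≥0∞} (hx : x ≤ tensorSobolevNormOn (1 / 2) (ball 0 R) k +
      sobolevNormOn (3 / 2) (ball 0 R) ψ₀ + sobolevNormOn (1 / 2) (ball 0 R) ψ₁) : x < M :=
    (hx.trans hN).trans_lt ((ENNReal.ofReal_lt_ofReal_iff (by positivity)).2 (by linarith))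
  have hkij (i j : Fin 3) : sobolevNormOn (1 / 2) (ball 0 R) (fun x => k x i j) < M := by
    refine hlt (le_trans ?_ (le_trans le_self_add le_self_add))
    unfold tensorSobolevNormOn
    exact (Finset.single_le_sum (f := fun j => sobolevNormOn (1 / 2) (ball 0 R) fun x => k x i j)
      (fun _ _ => zero_le) (Finset.mem_univ j)).trans
      (Finset.single_le_sum (f := fun i => ∑ j, sobolevNormOn (1 / 2) (ball 0 R) fun x => k x i j)
      (fun _ _ => zero_le) (Finset.mem_univ i))
  have hψ₀M : sobolevNormOn (3 / 2) (ball 0 R) ψ₀ < M := hlt (le_trans le_add_self le_self_add)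
  have hψ₁M : sobolevNormOn (1 / 2) (ball 0 R) ψ₁ < M := hlt le_add_self
  have hball : ball (0 : E3) ρ ⊆ ball 0 R := ball_subset_ball hρ.2.le
  have ck (i j : Fin 3) : ContinuousOn (fun x => k x i j) (ball 0 ρ) :=
    (hks.1 i j).continuousOn.mono hball
  have cψ₁ : ContinuousOn ψ₁ (ball 0 ρ) := hψ₁.continuousOn.mono hball
  have cpd (i : Fin 3) : ContinuousOn (pd i ψ₀) (ball 0 ρ) :=
    ((hψ₀.continuousOn_fderiv_of_isOpen isOpen_ball (by simp)).clm_apply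
      continuousOn_const).mono hball
  set e : ℝ → ℝ := fun t => u t ^ 2 + 2 * b t ^ 2 + deriv φ t ^ 2 + ψ t ^ 2 with he
  have sφ : ContDiffOn ℝ ∞ φ (Set.Ioo (-R) R) := hφd ▸ contDiffOn_comp_single 0 hψ₀
  have ce : ContinuousOn e (Set.Ico 0 R) := by
    have c1 : ContinuousOn u (Set.Ico 0 R) :=
      hud ▸ (contDiffOn_comp_single 0 (hks.1 0 0)).continuousOn.mono hsub
    have c2 : ContinuousOn b (Set.Ico 0 R) :=
      hbd ▸ (contDiffOn_comp_single 0 (hks.1 1 1)).continuousOn.mono hsub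
    have c3 : ContinuousOn ψ (Set.Ico 0 R) :=
      hψd ▸ (contDiffOn_comp_single 0 hψ₁).continuousOn.mono hsub
    have c4 : ContinuousOn (deriv φ) (Set.Ico 0 R) := fun t ht =>
      (hasDerivAt_of_contDiffOn isOpen_Ioo sφ (hsub ht)).2.continuousAt.continuousWithinAt
    fun_prop
  have hpt : ∀ᵐ x ∂(volume.restrict (ball (0 : E3) ρ)), ENNReal.ofReal (e ‖x‖) =
      (∑ i, ∑ j, ‖k x i j‖ₑ ^ 2) + (∑ i, ‖pd i ψ₀ x‖ₑ ^ 2) + ‖ψ₁ x‖ₑ ^ 2 := by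
    have hne : ∀ᵐ x : E3, x ≠ 0 := by simp [ae_iff]
    filter_upwards [ae_restrict_of_ae hne, ae_restrict_mem measurableSet_ball] with x hx0 hxρ
    have hx := hball hxρ
    have h1 := sum_sq_radial_tensor (hud ▸ hbd ▸ hk.isRadialTensorNear hx hx0 :
      IsRadialTensorNear k u b x)
    have hxI : ‖x‖ ∈ Set.Ico 0 R := ⟨norm_nonneg _, by simpa using hx⟩
    have h2 : ∑ i, pd i ψ₀ x ^ 2 = deriv φ ‖x‖ ^ 2 := by
      have h3 := pd_radial hx0 (f := φ) (f' := deriv φ ‖x‖)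
        (hasDerivAt_of_contDiffOn isOpen_Ioo sφ (hsub hxI)).1 (hφd ▸ hψ₀r.eventuallyEq hx hx0)
      have h4 : ∀ i, pd i ψ₀ x ^ 2 = (deriv φ ‖x‖ / ‖x‖) ^ 2 * (x i * x i) := fun i => by
        rw [h3]; ring
      rw [Finset.sum_congr rfl fun i _ => h4 i, ← Finset.mul_sum, norm_sq_eq_sum_mul]
      have : ‖x‖ ≠ 0 := norm_ne_zero_iff.2 hx0
      field_simp
    have h5 : ψ₁ x = ψ ‖x‖ := hψd ▸ (hψ₁r.eventuallyEq hx hx0).self_of_nhds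
    simp only [enorm_sq_eq_ofReal]
    have h6 : ∑ i, ∑ j, ENNReal.ofReal (k x i j ^ 2) =
        ENNReal.ofReal (∑ i, ∑ j, k x i j ^ 2) := by
      rw [ENNReal.ofReal_sum_of_nonneg fun i _ => Finset.sum_nonneg fun j _ => sq_nonneg (k x i j)]
      exact Finset.sum_congr rfl fun i _ =>
        (ENNReal.ofReal_sum_of_nonneg fun j _ => sq_nonneg (k x i j)).symm
    rw [h6, ← ENNReal.ofReal_sum_of_nonneg fun i _ => sq_nonneg _, h1, h2, h5,
      ← ENNReal.ofReal_add (by positivity) (by positivity),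
      ← ENNReal.ofReal_add (by positivity) (by positivity)]
  have hkey : ENNReal.ofReal (3 * volume.real (ball (0 : E3) 1) *
      ∫ t in (0 : ℝ)..ρ, t ^ 2 * e t) ≤
      ENNReal.ofReal (morreyConst * ρ * ((10 + 12 * Real.pi ^ 2) * (2 * ε) ^ 2)) := by
    rw [← lintegral_ball_radial ce (fun t => by positivity) hρ, lintegral_congr_ae hpt,
      lintegral_add_right' _ (aemeasurable_enorm_sq cψ₁),
      lintegral_add_right' _ (Finset.aemeasurable_fun_sum _ fun i _ => aemeasurable_enorm_sq (cpd i)),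
      lintegral_finsetSum' _ fun i _ =>
        Finset.aemeasurable_fun_sum _ fun j _ => aemeasurable_enorm_sq (ck i j),
      Finset.sum_congr rfl fun i _ =>
        lintegral_finsetSum' _ fun j _ => aemeasurable_enorm_sq (ck i j),
      lintegral_finsetSum' _ fun i _ => aemeasurable_enorm_sq (cpd i)]
    -- Nine components of k and one of ψ₁ give 10; three derivatives of ψ₀, each with (2π)², give
    -- 12π².
    calc _ ≤ (∑ _i : Fin 3, ∑ _j : Fin 3, ENNReal.ofReal (morreyConst * ρ) * M ^ 2) +
          (∑ _i : Fin 3, ENNReal.ofReal (morreyConst * ρ) *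
            (ENNReal.ofReal ((2 * Real.pi) ^ 2) * M ^ 2)) +
          ENNReal.ofReal (morreyConst * ρ) * M ^ 2 := by
          gcongr with i _ j _ i _
          · exact lintegral_ball_sq_le_of_sobolevNormOn_lt (hkij i j) hρ.1 hρ.2.le
          · exact lintegral_ball_pd_sq_le_of_sobolevNormOn_lt hψ₀M hψ₀ i hρ.1 hρ.2.le
          · exact lintegral_ball_sq_le_of_sobolevNormOn_lt hψ₁M hρ.1 hρ.2.le
      _ = _ := by
          have hρ0 := hρ.1
          rw [hM, ← ENNReal.ofReal_pow (by positivity), ← ENNReal.ofReal_mul (by positivity),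
            ← ENNReal.ofReal_mul (by positivity), ← ENNReal.ofReal_mul (by positivity)]
          simp only [Finset.sum_const, Finset.card_univ, Fintype.card_fin, ← ENNReal.ofReal_nsmul]
          rw [← ENNReal.ofReal_add (by positivity) (by positivity),
            ← ENNReal.ofReal_add (by positivity) (by positivity)]
          congr 1
          simp only [nsmul_eq_mul]
          push_cast
          ring
  have hρ0 := hρ.1
  exact (ENNReal.ofReal_le_ofReal_iff (by positivity)).1 hkey

/-! ### Choice of the constant and conclusion -/

theorem proposition4 :
    ∃ ε₀ : ℝ, 0 < ε₀ ∧
      ∀ (R : ℝ) (_ : 0 < R) (g k : Tensor2) (ψ₀ ψ₁ : E3 → ℝ) (r kρρ kϑϑ : ℝ → ℝ),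
        IsRiemannianMetricOn g (Metric.ball 0 R) →
        IsSymmetricTensorOn k (Metric.ball 0 R) →
        HasSphericalMetricForm g r R →
        HasSphericalTensorForm k kρρ kϑϑ R →
        ContDiffOn ℝ ∞ ψ₀ (Metric.ball 0 R) → IsRadialOn ψ₀ R →
        ContDiffOn ℝ ∞ ψ₁ (Metric.ball 0 R) → IsRadialOn ψ₁ R →
        EinsteinScalarConstraintsOn g k ψ₀ ψ₁ (Metric.ball 0 R) →
        tensorSobolevNormOn (1 / 2) (Metric.ball 0 R) k +
            sobolevNormOn (3 / 2) (Metric.ball 0 R) ψ₀ +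
            sobolevNormOn (1 / 2) (Metric.ball 0 R) ψ₁ ≤ ENNReal.ofReal ε₀ →
        ¬ ∃ S : Set E3, IsCompactEmbeddedSurface S ∧ IsSphericallySymmetricSet S ∧
            IsTrapped g k (Metric.ball 0 R) S := by
  have hV : 0 < volume.real (ball (0 : E3) 1) :=
    ENNReal.toReal_pos (measure_ball_pos _ _ one_pos).ne' measure_ball_lt_top.ne
  set V := volume.real (ball (0 : E3) 1)
  have hC := morreyConst_pos
  -- Chosen so that the energy bound, divided by the sphere area 3V, is exactly ρ/1000, the value of
  -- δ for which the continuity argument closes.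
  set ε := √(3 * V / (1000 * morreyConst * (10 + 12 * Real.pi ^ 2) * 4)) with hεdef
  have hε : 0 < ε := Real.sqrt_pos.2 (by positivity)
  have hε2 : ε ^ 2 = 3 * V / (1000 * morreyConst * (10 + 12 * Real.pi ^ 2) * 4) :=
    Real.sq_sqrt (by positivity)
  refine ⟨ε, hε, ?_⟩
  rintro R hR g k ψ₀ ψ₁ r kρρ kϑϑ hgm hks hg hk hψ₀ hψ₀r hψ₁ hψ₁r hc hN ⟨S, hS, hsym, htr⟩
  obtain ⟨ρ, hρ, hmem⟩ := exists_single_mem hS hsym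
  have hball : (EuclideanSpace.single 0 ρ : E3) ∈ ball (0 : E3) R := htr.1 hmem
  have hρR : ρ ∈ Set.Ioo 0 R := ⟨hρ, by simpa [abs_of_pos hρ] using hball⟩
  have hne : (EuclideanSpace.single 0 ρ : E3) ≠ 0 := by simpa using hρ.ne'
  have hrc := radialConstraints_of_constraints (δ := 1 / 1000) hR hgm hks hg hk hψ₀ hψ₀r hψ₁ hc
    rfl rfl rfl rfl rfl (fun ρ' hρ' => by
      have h1 := radial_energy_le hε hks hk hψ₀ hψ₀r hψ₁ hψ₁r rfl rfl rfl rfl hN hρ'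
      have h2 : morreyConst * ρ' * ((10 + 12 * Real.pi ^ 2) * (2 * ε) ^ 2) =
          3 * V * (1 / 1000 * ρ') := by
        rw [mul_pow, hε2]
        field_simp
        norm_num
      rw [h2] at h1
      exact le_of_mul_le_mul_left h1 (by positivity))
  have hlt := hrc.abs_κ_lt hρR
  have hα0 : 0 < g (EuclideanSpace.single 0 ρ) 1 1 := (hgm.2 _ hball).diag_pos
  have hdα := (hasDerivAt_of_contDiffOn isOpen_Ioo (contDiffOn_comp_single 0 (hgm.1 1 1))
    (show ρ ∈ Set.Ioo (-R) R from ⟨by linarith, hρR.2⟩)).1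
  have htrap := trapped_sphere hρ hS hsym hmem htr (hg.isRadialTensorNear hball hne)
    (hk.isRadialTensorNear hball hne) hα0 hdα
  set s := √(g (EuclideanSpace.single 0 ρ) 1 1) with hs
  have hs0 : 0 < s := Real.sqrt_pos.2 hα0
  have hss : s ^ 2 = g (EuclideanSpace.single 0 ρ) 1 1 := Real.sq_sqrt hα0.le
  rw [← hss] at htrap
  -- The trapping inequality is stated for κ and r' divided by s = √α = r/ρ; factoring out s makes
  -- it comparable with |κ| < |r'|.
  have e1 (a : ℝ) : s + ρ * a / (2 * s) = s * (1 + ρ * a / (2 * s ^ 2)) := by field_simp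
  have e2 (a : ℝ) : ρ * a / s = s * (ρ * a / s ^ 2) := by field_simp
  rw [e1, e2, abs_mul, abs_mul] at hlt
  have h3 := lt_of_mul_lt_mul_left hlt (abs_nonneg s)
  have h4 := neg_abs_le (ρ * k (EuclideanSpace.single 0 ρ) 1 1 / s ^ 2)
  linarith
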